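/- Let $d\in\mathbb N$, let $\Omega=(0,1)$ with Lebesgue measure, and let $\mathbb H=L^2(\Omega;\mathbb R^d)$. Make the following assumptions. (a) $L,H\in C^3(\mathbb R^d\times\mathbb R^d)$, and for every $q$ the functions $L(q,\cdot)$ and $H(q,\cdot)$ are Legendre transforms of each other. There are $c_0,c_1,\lambda_0>0$ such that $L\ge 0$, $c_0|v|^2\le L(q,v)$ and $|\nabla_qL(q,v)|\le c_1$ for all $q,v$, and $$\lambda_0|v_1-v_0|^2\le\frac{d^2}{d\varepsilon^2}L\big((1-\varepsilon)q_0+\varepsilon q_1,(1-\varepsilon)v_0+\varepsilon v_1\big)\qquad\text{for all }q_0,q_1,v_0,v_1\in\mathbb R^d,\ \varepsilon\in[0,1].$$ (b) $\Phi,\Psi\in C^3(\mathbb R^d)$ are even and bounded from below, have bounded derivatives of orders $1,2,3$, and satisfy $c_\Phi I_d\le\nabla^2\Phi$ and $c_\Psi I_d\le\nabla^2\Psi$ with real constants $c_\Phi,c_\Psi$. (c) $T>0$ and, with $c^-=\max\{-c,0\}$, $$T^2\big(c_\Phi^-+2\|\nabla^2\Phi\|_{L^\infty}\big)+T\big(c_\Psi^-+2\|\nabla^2\Psi\|_{L^\infty}\big)<\frac{\lambda_0}{2}.$$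 For a Banach space $V$, let $AC_2(0,t;V)$ be the set of absolutely continuous $\gamma:[0,t]\to V$ of the form $\gamma(s)=\gamma(0)+\int_0^s\dot\gamma\,d\tau$ with $\dot\gamma\in L^2(0,t;V)$. For $t\in[0,T]$ and $Y\in\mathbb H$, let $s\mapsto\gamma_t^s[Y]$, $s\in[0,t]$, be the minimizer of $$\int_0^t\Big(\int_\Omega L(\gamma,\dot\gamma)\,d\omega+\frac12\int_{\Omega^2}\Phi(\gamma(s,\omega)-\gamma(s,\tilde\omega))\,d\omega\,d\tilde\omega\Big)ds+\frac12\int_{\Omega^2}\Psi(\gamma(0,\omega)-\gamma(0,\tilde\omega))\,d\omega\,d\tilde\omega$$ over $\gamma\in AC_2(0,t;\mathbb H)$ with $\gamma(t)=Y$. Let $$\hat u(t,q,Y)=\inf_{r}\Big\{\int_0^t\Big(L(r(s),\dot r(s))+\int_\Omega\Phi(r(s)-\gamma_t^s[Y](\tilde\omega))\,d\tilde\omega\Big)ds+\int_\Omega\Psi(r(0)-\gamma_t^0[Y](\tilde\omega))\,d\tilde\omega\Big\},$$ where the infimum is over $r\in AC_2(0,t;\mathbb R^d)$ with $r(t)=q$.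 Paths along which the integral of $L$ is infinite have cost $+\infty$. Fix $X\in\mathbb H$ and set $$u(t,q)=\hat u(t,q,\gamma_T^t[X]),\qquad (t,q)\in[0,T]\times\mathbb R^d.$$ Then for all $t\in[0,T]$ and $Y\in\mathbb H$ the minimizer $\gamma_t^{\cdot}[Y]$ exists and is unique, and the partial derivatives $\partial_tu$ and $\nabla_qu$ exist and are continuous on $[0,T]\times\mathbb R^d$ (the time derivative being one-sided at $t=0$ and $t=T$). For all $t\in[0,T]$ and $q\in\mathbb R^d$, $$\partial_tu(t,q)+H(q,\nabla_qu(t,q))-\int_\Omega\Phi(q-\gamma_T^t[X](\tilde\omega))\,d\tilde\omega=0,$$ and for all $q\in\mathbb R^d$, $$u(0,q)=\int_\Omega\Psi(q-\gamma_T^0[X](\tilde\omega))\,d\tilde\omega.$$ -/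

import Mathlib

open Set MeasureTheory

noncomputable section

/-- Lebesgue measure on the set of player labels `Ω = (0,1)`. -/
abbrev labelMeasure : Measure ℝ := volume.restrict (Ioo (0 : ℝ) 1)

/-- The Hilbert space `L²((0,1); ℝᵈ)`. -/
abbrev LabelSpace (d : ℕ) : Type :=
  Lp (EuclideanSpace ℝ (Fin d)) 2 labelMeasure

/-- `g` is the Legendre transform of `f`: `g p = sup_v (⟨p, v⟩ - f v)`, the supremum being finite. -/
def IsLegendreTransform {E : Type*} [NormedAddCommGroup E] [InnerProductSpace ℝ E]
    (f g : E → ℝ) : Prop :=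
  ∀ p : E, IsLUB (range fun v : E => inner ℝ p v - f v) (g p)

/-- `γ ∈ AC₂(0,t;V)` with velocity `γ'`: the velocity is square integrable on `(0,t)` and `γ` is its
primitive. The velocity is determined by `γ` up to a null set. -/
def IsAC2 {V : Type*} [NormedAddCommGroup V] [NormedSpace ℝ V] (t : ℝ) (γ γ' : ℝ → V) : Prop :=
  MemLp γ' 2 (volume.restrict (Ioc 0 t)) ∧ ∀ s ∈ Icc 0 t, γ s = γ 0 + ∫ τ in (0 : ℝ)..s, γ' τ

variable {d : ℕ}

/-- `∫_Ω W(q - X(ω)) dω`; this is `F(q,X)` for `W = Φ` and `G(q,X)` for `W = Ψ`. -/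
def interaction (W : EuclideanSpace ℝ (Fin d) → ℝ) (q : EuclideanSpace ℝ (Fin d))
    (X : LabelSpace d) : ℝ :=
  ∫ ω, W (q - X ω) ∂labelMeasure

/-- `½ ∫∫_{Ω²} W(X(ω) - X(ω')) dω dω'`; for `W = Ψ` this is the initial cost functional. -/
def totalInteraction (W : EuclideanSpace ℝ (Fin d) → ℝ) (X : LabelSpace d) : ℝ :=
  1 / 2 * ∫ ω, ∫ ω', W (X ω - X ω') ∂labelMeasure ∂labelMeasure

/-- The collective Lagrangian `L̂(X,V) = ∫_Ω L(X,V) dω + ½ ∫∫_{Ω²} Φ(X(ω) - X(ω')) dω dω'`. -/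
def collectiveLagrangian (L : EuclideanSpace ℝ (Fin d) → EuclideanSpace ℝ (Fin d) → ℝ)
    (Φ : EuclideanSpace ℝ (Fin d) → ℝ) (X V : LabelSpace d) : ℝ :=
  ∫ ω, L (X ω) (V ω) ∂labelMeasure + totalInteraction Φ X

/-- The collective cost `B̂₀ᵗ(γ) = ∫₀ᵗ L̂(γ, γ') ds + U_*(γ(0))`. -/
def collectiveCost (L : EuclideanSpace ℝ (Fin d) → EuclideanSpace ℝ (Fin d) → ℝ)
    (Φ Ψ : EuclideanSpace ℝ (Fin d) → ℝ) (t : ℝ) (γ γ' : ℝ → LabelSpace d) : ℝ :=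
  (∫ s in (0 : ℝ)..t, collectiveLagrangian L Φ (γ s) (γ' s)) + totalInteraction Ψ (γ 0)

/-- The competitors in the collective problem on `[0,t]` with terminal value `Y`: paths in
`AC₂(0,t; L²(Ω;ℝᵈ))` ending at `Y`, along which `∫₀ᵗ ∫_Ω L(γ, γ') dω ds` is finite (the cost of any
other path is `+∞`, as `L ≥ 0`). -/
def IsCollectivePath (L : EuclideanSpace ℝ (Fin d) → EuclideanSpace ℝ (Fin d) → ℝ)
    (t : ℝ) (Y : LabelSpace d) (γ γ' : ℝ → LabelSpace d) : Prop :=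
  IsAC2 t γ γ' ∧ γ t = Y ∧
  (∀ᵐ s ∂volume.restrict (Ioc 0 t), Integrable (fun ω => L (γ s ω) (γ' s ω)) labelMeasure) ∧
  IntervalIntegrable (fun s => ∫ ω, L (γ s ω) (γ' s ω) ∂labelMeasure) volume 0 t

/-- `γ` minimizes `B̂₀ᵗ` among the paths with terminal value `Y`. -/
def IsCollectiveMinimizer (L : EuclideanSpace ℝ (Fin d) → EuclideanSpace ℝ (Fin d) → ℝ)
    (Φ Ψ : EuclideanSpace ℝ (Fin d) → ℝ) (t : ℝ) (Y : LabelSpace d)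
    (γ : ℝ → LabelSpace d) : Prop :=
  ∃ γ' : ℝ → LabelSpace d, IsCollectivePath L t Y γ γ' ∧
    ∀ η η' : ℝ → LabelSpace d, IsCollectivePath L t Y η η' →
      collectiveCost L Φ Ψ t γ γ' ≤ collectiveCost L Φ Ψ t η η'

open Classical in
/-- The minimizer `s ↦ γ_t^s[Y]` of the collective problem; only its values for `s ∈ [0,t]` are
meaningful. -/
def minimizingPath (L : EuclideanSpace ℝ (Fin d) → EuclideanSpace ℝ (Fin d) → ℝ)
    (Φ Ψ : EuclideanSpace ℝ (Fin d) → ℝ) (t : ℝ) (Y : LabelSpace d) : ℝ → LabelSpace d :=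
  if h : ∃ γ, IsCollectiveMinimizer L Φ Ψ t Y γ then h.choose else fun _ => Y

/-- The cost of the path `r` with velocity `r'` for one player, when the population follows `γ`:
`∫₀ᵗ L(r, r') + F(r, γ(s)) ds + G(r(0), γ(0))`. -/
def individualCost (L : EuclideanSpace ℝ (Fin d) → EuclideanSpace ℝ (Fin d) → ℝ)
    (Φ Ψ : EuclideanSpace ℝ (Fin d) → ℝ) (t : ℝ) (γ : ℝ → LabelSpace d)
    (r r' : ℝ → EuclideanSpace ℝ (Fin d)) : ℝ :=
  (∫ s in (0 : ℝ)..t, (L (r s) (r' s) + interaction Φ (r s) (γ s))) + interaction Ψ (r 0) (γ 0)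

/-- `û(t,q,Y)`: the infimum of the individual cost over the paths `r ∈ AC₂(0,t;ℝᵈ)` with `r(t) = q`
and finite cost, when the population follows `s ↦ γ_t^s[Y]`. -/
def optimalIndividualCost (L : EuclideanSpace ℝ (Fin d) → EuclideanSpace ℝ (Fin d) → ℝ)
    (Φ Ψ : EuclideanSpace ℝ (Fin d) → ℝ) (t : ℝ) (q : EuclideanSpace ℝ (Fin d))
    (Y : LabelSpace d) : ℝ :=
  sInf {c : ℝ | ∃ r r' : ℝ → EuclideanSpace ℝ (Fin d),
    IsAC2 t r r' ∧ r t = q ∧ IntervalIntegrable (fun s => L (r s) (r' s)) volume 0 t ∧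
    c = individualCost L Φ Ψ t (minimizingPath L Φ Ψ t Y) r r'}

/-- The individual value function `u(t,q) = û(t, q, γ_T^t[X])`. -/
def individualValue (L : EuclideanSpace ℝ (Fin d) → EuclideanSpace ℝ (Fin d) → ℝ)
    (Φ Ψ : EuclideanSpace ℝ (Fin d) → ℝ) (T : ℝ) (X : LabelSpace d)
    (t : ℝ) (q : EuclideanSpace ℝ (Fin d)) : ℝ :=
  optimalIndividualCost L Φ Ψ t q (minimizingPath L Φ Ψ T X t)

/-- Assumptions on an interaction function `W` with lower Hessian bound `c`: it is even, of class
`C³`, bounded from below, has bounded derivatives of orders one to three, and `c I ≤ ∇²W`. -/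
structure IsInteractionFunction (W : EuclideanSpace ℝ (Fin d) → ℝ) (c : ℝ) : Prop where
  contDiff : ContDiff ℝ 3 W
  even : ∀ x, W (-x) = W x
  bddBelow : ∃ m : ℝ, ∀ x, m ≤ W x
  bdd_deriv : ∀ k ∈ Icc 1 3, ∃ C : ℝ, ∀ x, ‖iteratedFDeriv ℝ k W x‖ ≤ C
  hessian_ge : ∀ x v, c * ‖v‖ ^ 2 ≤ iteratedFDeriv ℝ 2 W x ![v, v]

/-- Assumptions on the Lagrangian `L`, with constants `c₀, c₁, l₀`. -/
structure IsAdmissibleLagrangian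
    (L : EuclideanSpace ℝ (Fin d) → EuclideanSpace ℝ (Fin d) → ℝ) (c₀ c₁ l₀ : ℝ) : Prop where
  contDiff : ContDiff ℝ 3 (Function.uncurry L)
  nonneg : ∀ q v, 0 ≤ L q v
  lower_bound : ∀ q v, c₀ * ‖v‖ ^ 2 ≤ L q v
  gradient_bound : ∀ q v, ‖gradient (fun x => L x v) q‖ ≤ c₁
  convexity : ∀ q₀ q₁ v₀ v₁, ∀ ε ∈ Icc (0 : ℝ) 1, l₀ * ‖v₁ - v₀‖ ^ 2 ≤
    iteratedDeriv 2 (fun e : ℝ => L ((1 - e) • q₀ + e • q₁) ((1 - e) • v₀ + e • v₁)) ε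

end

/-! The population and the single player solve the same kind of problem: minimize an action,
strongly convex in the velocity, plus semiconvex potentials, over paths with prescribed terminal
value. `IsConvexProblem` abstracts it on a normed space, with actions in [0,∞]; it is used for V =
`LabelSpace d` and for V = ℝᵈ.

The engine is `IsConvexProblem.pathCost_convex`. Two paths with the same terminal value differ
uniformly by at most a multiple of the L² distance of their velocities, so for small T the convexity
of the action beats the concavity of the potentials, and the cost is strongly convex in the
velocity. Hence minimizing sequences have Cauchy velocities, and minimizers exist
(`exists_minimizer`) and are unique as paths (`eqOn_of_minimizers`).

The link between the two problems is consistency in time. A minimizer on [0,T] cut at time t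
minimizes on [0,t] for its own value at t (`minimizer_truncate`). By uniqueness, the population path
entering û(t, ·, γ_T^t[X]) is the restriction of the single curve γ_T[X]. So u(t,·) is, for every t,
the value function of one individual problem with a fixed time-dependent potential.

For that value function, convex combinations of minimizers give semiconvexity in q. The cost of a
translated minimizer is a differentiable function touching the value from above. Together these
force differentiability (`hasFDerivAt_of_touching`). The gradient inequality and Lipschitz bounds in
time and space make the gradient jointly continuous (`continuousOn_gradient`).

The equation then follows from dynamic programming on short intervals. A straight line with nearly
optimal velocity bounds the increase of u from above (`value_sub_le`). Fenchel's inequality along a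
minimizer, with the constant momentum ∇u(s,q), bounds it from below (`le_value_sub`). Both errors
are o(t - s), so ∂ₜu = F - H(q,∇u), where F is the interaction potential, and continuity of ∂ₜu can
be read off from this formula. Neither Euler–Lagrange equations nor characteristics are needed. -/

section

open Filter Topology ENNReal

/-! ### Absolutely continuous paths with square integrable velocity -/

section Paths

/-- The Cauchy–Schwarz inequality for the integral of the norm over a bounded interval. -/
theorem sq_integral_norm_le {V : Type*} [NormedAddCommGroup V] {a b : ℝ} (hab : a ≤ b) {w : ℝ → V}
    (hw : MemLp w 2 (volume.restrict (Ioc a b))) :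
    (∫ τ in a..b, ‖w τ‖) ^ 2 ≤ (b - a) * ∫ τ in a..b, ‖w τ‖ ^ 2 := by
  rcases hab.eq_or_lt with rfl | hlt
  · simp
  have h1 : IntervalIntegrable (fun τ => ‖w τ‖) volume a b :=
    (intervalIntegrable_iff_integrableOn_Ioc_of_le hab).2 (hw.integrable (by norm_num)).norm
  have h2 : IntervalIntegrable (fun τ => ‖w τ‖ ^ 2) volume a b :=
    (intervalIntegrable_iff_integrableOn_Ioc_of_le hab).2
      (hw.integrable_norm_pow (p := 2) two_ne_zero)
  -- This is ∫ (‖w‖ - c)² ≥ 0. The mean of ‖w‖ is the optimal c, whence the division by b - a below.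
  have key : ∀ c : ℝ, 0 ≤ (∫ τ in a..b, ‖w τ‖ ^ 2) - 2 * c * (∫ τ in a..b, ‖w τ‖)
      + (b - a) * c ^ 2 := by
    intro c
    have h3 : 0 ≤ ∫ τ in a..b, (‖w τ‖ ^ 2 - 2 * c * ‖w τ‖ + c ^ 2) :=
      intervalIntegral.integral_nonneg hab fun τ _ => by nlinarith [sq_nonneg (‖w τ‖ - c)]
    rw [intervalIntegral.integral_add (h2.sub (h1.const_mul _)) (by simp),
      intervalIntegral.integral_sub h2 (h1.const_mul _), intervalIntegral.integral_const_mul,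
      intervalIntegral.integral_const, smul_eq_mul] at h3
    exact h3
  have hpos : 0 < b - a := sub_pos.2 hlt
  have h4 := key ((∫ τ in a..b, ‖w τ‖) / (b - a))
  generalize (∫ τ in a..b, ‖w τ‖) = A at *
  generalize (∫ τ in a..b, ‖w τ‖ ^ 2) = B at *
  have h5 : B - 2 * (A / (b - a)) * A + (b - a) * (A / (b - a)) ^ 2 = B - A ^ 2 / (b - a) := by
    field_simp; ring
  rw [h5, sub_nonneg, div_le_iff₀ hpos] at h4
  linarith

variable {V : Type*} [NormedAddCommGroup V] [NormedSpace ℝ V]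

namespace IsAC2

variable {t : ℝ} {γ γ' η η' : ℝ → V}

theorem memLp_subinterval (h : IsAC2 t γ γ') {a b : ℝ} (ha : 0 ≤ a) (hb : b ≤ t) :
    MemLp γ' 2 (volume.restrict (Ioc a b)) :=
  h.1.mono_measure (Measure.restrict_mono (Ioc_subset_Ioc ha hb) le_rfl)

theorem intervalIntegrable (h : IsAC2 t γ γ') {a b : ℝ} (ha : 0 ≤ a) (hab : a ≤ b) (hb : b ≤ t) :
    IntervalIntegrable γ' volume a b :=
  (intervalIntegrable_iff_integrableOn_Ioc_of_le hab).2
    ((h.memLp_subinterval ha hb).integrable (by norm_num))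

theorem intervalIntegrable_sq (h : IsAC2 t γ γ') {a b : ℝ} (ha : 0 ≤ a) (hab : a ≤ b)
    (hb : b ≤ t) : IntervalIntegrable (fun τ => ‖γ' τ‖ ^ 2) volume a b :=
  (intervalIntegrable_iff_integrableOn_Ioc_of_le hab).2
    ((h.memLp_subinterval ha hb).integrable_norm_pow (p := 2) two_ne_zero)

theorem sub_eq (h : IsAC2 t γ γ') {a b : ℝ} (ha : 0 ≤ a) (hab : a ≤ b) (hb : b ≤ t) :
    γ b - γ a = ∫ τ in a..b, γ' τ := by
  rw [h.2 a ⟨ha, hab.trans hb⟩, h.2 b ⟨ha.trans hab, hb⟩, add_sub_add_left_eq_sub,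
    intervalIntegral.integral_interval_sub_left
      (h.intervalIntegrable le_rfl (ha.trans hab) hb)
      (h.intervalIntegrable le_rfl ha (hab.trans hb))]

theorem norm_sub_sq_le (h : IsAC2 t γ γ') {a b : ℝ} (ha : 0 ≤ a) (hab : a ≤ b) (hb : b ≤ t) :
    ‖γ b - γ a‖ ^ 2 ≤ (b - a) * ∫ τ in a..b, ‖γ' τ‖ ^ 2 := by
  rw [h.sub_eq ha hab hb]
  refine le_trans ?_ (sq_integral_norm_le hab (h.memLp_subinterval ha hb))
  gcongr
  exact intervalIntegral.norm_integral_le_integral_norm hab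

theorem integral_sq_mono (h : IsAC2 t γ γ') {a b c : ℝ} (ha : 0 ≤ a) (hab : a ≤ b) (hbc : b ≤ c)
    (hc : c ≤ t) : ∫ τ in b..c, ‖γ' τ‖ ^ 2 ≤ ∫ τ in a..c, ‖γ' τ‖ ^ 2 := by
  rw [← intervalIntegral.integral_add_adjacent_intervals
    (h.intervalIntegrable_sq ha hab (hbc.trans hc))
    (h.intervalIntegrable_sq (ha.trans hab) hbc hc)]
  have : 0 ≤ ∫ τ in a..b, ‖γ' τ‖ ^ 2 :=
    intervalIntegral.integral_nonneg hab fun τ _ => by positivity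
  linarith

theorem continuousOn (h : IsAC2 t γ γ') : ContinuousOn γ (Icc 0 t) := by
  rcases lt_or_ge t 0 with ht | ht
  · simp [Icc_eq_empty (not_le.2 ht)]
  have h1 : ContinuousOn (fun s => γ 0 + ∫ τ in (0 : ℝ)..s, γ' τ) (uIcc 0 t) :=
    continuousOn_const.add (intervalIntegral.continuousOn_primitive_interval
      ((intervalIntegrable_iff' (by simp)).1 (h.intervalIntegrable le_rfl ht le_rfl)))
  rw [uIcc_of_le ht] at h1
  exact h1.congr fun s hs => h.2 s hs

theorem aestronglyMeasurable (h : IsAC2 t γ γ') :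
    AEStronglyMeasurable γ (volume.restrict (Ioc 0 t)) :=
  (h.continuousOn.mono Ioc_subset_Icc_self).aestronglyMeasurable measurableSet_Ioc

/-- The increment back from time t is controlled by the kinetic energy. Applied to a difference of
two paths, this turns closeness of velocities in L² into uniform closeness of the paths. -/
theorem norm_sq_le_terminal (h : IsAC2 t γ γ') {s : ℝ} (hs : s ∈ Icc 0 t) :
    ‖γ s‖ ^ 2 ≤ 2 * ‖γ t‖ ^ 2 + 2 * t * ∫ τ in (0 : ℝ)..t, ‖γ' τ‖ ^ 2 := by
  have h1 := h.norm_sub_sq_le hs.1 hs.2 le_rfl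
  have h2 := h.integral_sq_mono le_rfl hs.1 hs.2 le_rfl
  have h0 : 0 ≤ ∫ τ in s..t, ‖γ' τ‖ ^ 2 :=
    intervalIntegral.integral_nonneg hs.2 fun τ _ => by positivity
  have h3 : (t - s) * ∫ τ in s..t, ‖γ' τ‖ ^ 2 ≤ t * ∫ τ in (0 : ℝ)..t, ‖γ' τ‖ ^ 2 :=
    mul_le_mul (by linarith [hs.1]) h2 h0 (hs.1.trans hs.2)
  have h4 : ‖γ s‖ ≤ ‖γ t‖ + ‖γ t - γ s‖ := by
    have := norm_sub_le (γ t) (γ t - γ s)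
    simpa using this
  have h5 : ‖γ s‖ ^ 2 ≤ (‖γ t‖ + ‖γ t - γ s‖) ^ 2 := by gcongr
  nlinarith [sq_nonneg (‖γ t‖ - ‖γ t - γ s‖)]

theorem const (t : ℝ) (y : V) : IsAC2 t (fun _ => y) (fun _ => 0) :=
  ⟨MemLp.zero', by simp⟩

theorem affine [CompleteSpace V] (t : ℝ) (x v : V) (s : ℝ) : IsAC2 t (fun τ => x + (τ - s) • v) (fun _ => v) := by
  refine ⟨memLp_const v, fun τ _ => ?_⟩
  simp only [intervalIntegral.integral_const, sub_zero, zero_sub]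
  module

theorem add (h : IsAC2 t γ γ') (k : IsAC2 t η η') :
    IsAC2 t (fun s => γ s + η s) (fun s => γ' s + η' s) := by
  refine ⟨h.1.add k.1, fun s hs => ?_⟩
  beta_reduce
  rw [intervalIntegral.integral_add (h.intervalIntegrable le_rfl hs.1 hs.2)
    (k.intervalIntegrable le_rfl hs.1 hs.2), h.2 s hs, k.2 s hs]
  abel

theorem smul (a : ℝ) (h : IsAC2 t γ γ') : IsAC2 t (fun s => a • γ s) (fun s => a • γ' s) := by
  refine ⟨h.1.const_smul a, fun s hs => ?_⟩
  beta_reduce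
  rw [intervalIntegral.integral_smul, h.2 s hs, smul_add]

theorem sub (h : IsAC2 t γ γ') (k : IsAC2 t η η') :
    IsAC2 t (fun s => γ s - η s) (fun s => γ' s - η' s) := by
  simpa [sub_eq_add_neg] using h.add (k.smul (-1))

theorem mono (h : IsAC2 t γ γ') {s : ℝ} (hs : s ≤ t) : IsAC2 s γ γ' :=
  ⟨h.memLp_subinterval le_rfl hs, fun τ hτ => h.2 τ ⟨hτ.1, hτ.2.trans hs⟩⟩

/-- Following `η` until time `s` and `γ` afterwards. -/
theorem concat {s : ℝ} (h0 : 0 ≤ s) (hst : s ≤ t) (k : IsAC2 s η η') (h : IsAC2 t γ γ')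
    (hs : η s = γ s) :
    IsAC2 t ((Iic s).piecewise η γ) ((Iic s).piecewise η' γ') := by
  have hmem : MemLp ((Iic s).piecewise η' γ') 2 (volume.restrict (Ioc 0 t)) := by
    refine MemLp.piecewise measurableSet_Iic ?_ ?_
    · rw [Measure.restrict_restrict measurableSet_Iic]
      refine k.1.mono_measure (Measure.restrict_mono
        (show Iic s ∩ Ioc 0 t ⊆ Ioc 0 s from fun τ hτ => ⟨hτ.2.1, hτ.1⟩) le_rfl)
    · rw [Measure.restrict_restrict measurableSet_Iic.compl]
      exact h.1.mono_measure (Measure.restrict_mono inter_subset_right le_rfl)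
  have hleft : ∀ τ ∈ Icc 0 s,
      (Iic s).piecewise η γ τ = η 0 + ∫ ρ in (0 : ℝ)..τ, (Iic s).piecewise η' γ' ρ := by
    intro τ hτ
    rw [piecewise_eq_of_mem _ _ _ (show τ ∈ Iic s from hτ.2), k.2 τ hτ]
    congr 1
    refine intervalIntegral.integral_congr fun ρ hρ => ?_
    rw [uIcc_of_le hτ.1] at hρ
    exact (piecewise_eq_of_mem _ _ _ (show ρ ∈ Iic s from hρ.2.trans hτ.2)).symm
  refine ⟨hmem, fun τ hτ => ?_⟩
  rw [piecewise_eq_of_mem (Iic s) η γ (show (0 : ℝ) ∈ Iic s from h0)]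
  rcases le_or_gt τ s with hτs | hτs
  · exact hleft τ ⟨hτ.1, hτs⟩
  have hint : ∀ a b, 0 ≤ a → a ≤ b → b ≤ t →
      IntervalIntegrable ((Iic s).piecewise η' γ') volume a b := fun a b ha hab hb =>
    (intervalIntegrable_iff_integrableOn_Ioc_of_le hab).2
      ((hmem.mono_measure (Measure.restrict_mono (Ioc_subset_Ioc ha hb) le_rfl)).integrable
        (by norm_num))
  rw [← intervalIntegral.integral_add_adjacent_intervals (hint 0 s le_rfl h0 hst)
    (hint s τ h0 hτs.le hτ.2), ← add_assoc, ← hleft s ⟨h0, le_rfl⟩,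
    piecewise_eq_of_mem (Iic s) η γ (show s ∈ Iic s from le_refl s), hs,
    piecewise_eq_of_notMem (Iic s) η γ (show τ ∉ Iic s from not_le.2 hτs)]
  have : ∫ ρ in s..τ, (Iic s).piecewise η' γ' ρ = ∫ ρ in s..τ, γ' ρ := by
    refine intervalIntegral.integral_congr_ae (Eventually.of_forall fun ρ hρ => ?_)
    rw [uIoc_of_le hτs.le] at hρ
    exact piecewise_eq_of_notMem _ _ _ (show ρ ∉ Iic s from not_le.2 hρ.1)
  rw [this, ← h.sub_eq h0 hτs.le hτ.2]
  abel

/-- The path with prescribed terminal value and velocity. -/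
theorem of_velocity (y : V) {w : ℝ → V}
    (hw : MemLp w 2 (volume.restrict (Ioc 0 t))) :
    IsAC2 t (fun s => y - ∫ τ in s..t, w τ) w := by
  refine ⟨hw, fun s hs => ?_⟩
  have hint : ∀ a b, 0 ≤ a → a ≤ b → b ≤ t → IntervalIntegrable w volume a b :=
    fun a b ha hab hb => (intervalIntegrable_iff_integrableOn_Ioc_of_le hab).2
      ((hw.mono_measure (Measure.restrict_mono (Ioc_subset_Ioc ha hb) le_rfl)).integrable
        (by norm_num))
  simp only
  rw [← intervalIntegral.integral_add_adjacent_intervals (hint 0 s le_rfl hs.1 hs.2)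
    (hint s t hs.1 hs.2 le_rfl)]
  abel

end IsAC2

end Paths

/-! ### Strongly convex variational problems on path space -/

section ConvexProblem

variable {V : Type*} [NormedAddCommGroup V] [NormedSpace ℝ V]

/-- Paths of finite action in `AC₂(0,t;V)` with terminal value `y`. -/
structure IsAdmissiblePath (Λ : V → V → ℝ≥0∞) (t : ℝ) (y : V) (γ γ' : ℝ → V) : Prop where
  ac : IsAC2 t γ γ'
  terminal : γ t = y
  finite : ∫⁻ s in Ioc 0 t, Λ (γ s) (γ' s) ≠ ∞

/-- The action of a path plus its potential energy and its initial cost. -/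
noncomputable def pathCost (Λ : V → V → ℝ≥0∞) (f : ℝ → V → ℝ) (g : V → ℝ) (t : ℝ) (γ γ' : ℝ → V) : ℝ :=
  (∫⁻ s in Ioc 0 t, Λ (γ s) (γ' s)).toReal + (∫ s in (0 : ℝ)..t, f s (γ s)) + g (γ 0)

/-- A lower semicontinuous Lagrangian that is strongly convex in the velocity with constant `l`,
and Lipschitz, semiconvex potentials whose concavity is dominated by `l` on `[0,T]`. -/
structure IsConvexProblem (Λ : V → V → ℝ≥0∞) (f : ℝ → V → ℝ) (g : V → ℝ)
    (T l cf cg K m : ℝ) : Prop where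
  lsc : LowerSemicontinuous fun z : V × V => Λ z.1 z.2
  rest_finite : ∀ y, Λ y 0 ≠ ∞
  convex : ∀ x₀ x₁ v₀ v₁ : V, ∀ a b : ℝ, 0 ≤ a → 0 ≤ b → a + b = 1 →
    Λ (a • x₀ + b • x₁) (a • v₀ + b • v₁) + ENNReal.ofReal (a * b * (l / 2) * ‖v₀ - v₁‖ ^ 2) ≤
      ENNReal.ofReal a * Λ x₀ v₀ + ENNReal.ofReal b * Λ x₁ v₁
  potential_cont : Continuous (Function.uncurry f)
  potential_lip : ∀ s x y, |f s x - f s y| ≤ K * ‖x - y‖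
  potential_ge : ∀ s x, m ≤ f s x
  potential_semiconvex : ∀ s x y, ∀ a b : ℝ, 0 ≤ a → 0 ≤ b → a + b = 1 →
    f s (a • x + b • y) ≤ a * f s x + b * f s y + a * b * (cf / 2) * ‖x - y‖ ^ 2
  initial_lip : ∀ x y, |g x - g y| ≤ K * ‖x - y‖
  initial_ge : ∀ x, m ≤ g x
  initial_semiconvex : ∀ x y, ∀ a b : ℝ, 0 ≤ a → 0 ≤ b → a + b = 1 →
    g (a • x + b • y) ≤ a * g x + b * g y + a * b * (cg / 2) * ‖x - y‖ ^ 2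
  T_nonneg : 0 ≤ T
  l_nonneg : 0 ≤ l
  cf_nonneg : 0 ≤ cf
  cg_nonneg : 0 ≤ cg
  K_nonneg : 0 ≤ K
  small : 2 * (T ^ 2 * cf + T * cg) < l

theorem IsAdmissiblePath.finite_subset {Λ : V → V → ℝ≥0∞} {t : ℝ} {y : V} {γ γ' : ℝ → V}
    (h : IsAdmissiblePath Λ t y γ γ') {A : Set ℝ} (hA : A ⊆ Ioc 0 t) :
    ∫⁻ s in A, Λ (γ s) (γ' s) ≠ ∞ :=
  ne_top_of_le_ne_top h.finite (lintegral_mono_set hA)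

theorem IsAdmissiblePath.truncate {Λ : V → V → ℝ≥0∞} {t : ℝ} {y : V} {γ γ' : ℝ → V}
    (h : IsAdmissiblePath Λ t y γ γ') {s : ℝ} (hs : s ≤ t) :
    IsAdmissiblePath Λ s (γ s) γ γ' :=
  ⟨h.ac.mono hs, rfl, h.finite_subset (Ioc_subset_Ioc_right hs)⟩

namespace IsConvexProblem

variable {Λ : V → V → ℝ≥0∞} {f : ℝ → V → ℝ} {g : V → ℝ} {T l cf cg K m : ℝ}
  {t : ℝ} {y y₀ y₁ : V} {γ γ' γ₀ γ₀' γ₁ γ₁' η η' : ℝ → V}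

theorem aemeasurable_running (P : IsConvexProblem Λ f g T l cf cg K m) (h : IsAC2 t γ γ') :
    AEMeasurable (fun s => Λ (γ s) (γ' s)) (volume.restrict (Ioc 0 t)) := by
  borelize (V × V)
  exact P.lsc.measurable.comp_aemeasurable
    (h.aestronglyMeasurable.prodMk h.1.1).aemeasurable

theorem intervalIntegrable_potential (P : IsConvexProblem Λ f g T l cf cg K m)
    (h : IsAC2 t γ γ') {a b : ℝ} (ha : 0 ≤ a) (hab : a ≤ b) (hb : b ≤ t) :
    IntervalIntegrable (fun s => f s (γ s)) volume a b := by
  refine ContinuousOn.intervalIntegrable ?_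
  rw [uIcc_of_le hab]
  exact P.potential_cont.comp_continuousOn
    (continuousOn_id.prodMk (h.continuousOn.mono (Icc_subset_Icc ha hb)))

theorem initial_cont (P : IsConvexProblem Λ f g T l cf cg K m) : Continuous g :=
  (LipschitzWith.of_dist_le_mul (K := K.toNNReal) fun x y => by
    rw [Real.dist_eq, dist_eq_norm, Real.coe_toNNReal _ P.K_nonneg]
    exact P.initial_lip x y).continuous

/-- Staying in [0,∞] avoids any finiteness assumption on the combined path; finiteness of its action
is then a consequence. -/
theorem running_convex (P : IsConvexProblem Λ f g T l cf cg K m) (ht : 0 ≤ t)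
    (h₀ : IsAdmissiblePath Λ t y₀ γ₀ γ₀') (h₁ : IsAdmissiblePath Λ t y₁ γ₁ γ₁') {a b : ℝ}
    (ha : 0 ≤ a) (hb : 0 ≤ b) (hab : a + b = 1) :
    (∫⁻ s in Ioc 0 t, Λ (a • γ₀ s + b • γ₁ s) (a • γ₀' s + b • γ₁' s)) +
      ENNReal.ofReal (a * b * (l / 2) * ∫ s in (0 : ℝ)..t, ‖γ₀' s - γ₁' s‖ ^ 2) ≤
    ENNReal.ofReal a * (∫⁻ s in Ioc 0 t, Λ (γ₀ s) (γ₀' s)) +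
      ENNReal.ofReal b * (∫⁻ s in Ioc 0 t, Λ (γ₁ s) (γ₁' s)) := by
  have hd := h₀.ac.sub h₁.ac
  have hc := P.l_nonneg
  have hint := (hd.intervalIntegrable_sq le_rfl ht le_rfl).const_mul (a * b * (l / 2))
  rw [← intervalIntegral.integral_const_mul, intervalIntegral.integral_of_le ht,
    ofReal_integral_eq_lintegral_ofReal
      ((intervalIntegrable_iff_integrableOn_Ioc_of_le ht).1 hint)
      (Eventually.of_forall fun s => by positivity),
    ← lintegral_const_mul'' _ (P.aemeasurable_running h₀.ac),
    ← lintegral_const_mul'' _ (P.aemeasurable_running h₁.ac),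
    ← lintegral_add_left' ((P.aemeasurable_running h₀.ac).const_mul _),
    ← lintegral_add_left' (P.aemeasurable_running ((h₀.ac.smul a).add (h₁.ac.smul b)))]
  exact lintegral_mono fun s => P.convex _ _ _ _ a b ha hb hab

theorem admissible_convex (P : IsConvexProblem Λ f g T l cf cg K m) (ht : 0 ≤ t)
    (h₀ : IsAdmissiblePath Λ t y₀ γ₀ γ₀') (h₁ : IsAdmissiblePath Λ t y₁ γ₁ γ₁') {a b : ℝ}
    (ha : 0 ≤ a) (hb : 0 ≤ b) (hab : a + b = 1) :
    IsAdmissiblePath Λ t (a • y₀ + b • y₁) (fun s => a • γ₀ s + b • γ₁ s)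
      (fun s => a • γ₀' s + b • γ₁' s) := by
  refine ⟨(h₀.ac.smul a).add (h₁.ac.smul b), by simp [h₀.terminal, h₁.terminal], ?_⟩
  refine ne_top_of_le_ne_top ?_ (le_self_add.trans (P.running_convex ht h₀ h₁ ha hb hab))
  exact ENNReal.add_ne_top.2 ⟨ENNReal.mul_ne_top ofReal_ne_top h₀.finite,
    ENNReal.mul_ne_top ofReal_ne_top h₁.finite⟩

/-- With E the energy of the velocity difference, the squared distance of the paths is at most 2‖y₀
- y₁‖² + 2TE. The potentials therefore lose at most (cf/2)·T·2TE + (cg/2)·2TE = (T²cf + T cg)E,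
against a gain (l/2)E from the action. The terminal values contribute the remainder (T cf + cg)‖y₀ -
y₁‖². -/
theorem pathCost_convex (P : IsConvexProblem Λ f g T l cf cg K m) (ht : t ∈ Icc 0 T)
    (h₀ : IsAdmissiblePath Λ t y₀ γ₀ γ₀') (h₁ : IsAdmissiblePath Λ t y₁ γ₁ γ₁') {a b : ℝ}
    (ha : 0 ≤ a) (hb : 0 ≤ b) (hab : a + b = 1) :
    pathCost Λ f g t (fun s => a • γ₀ s + b • γ₁ s) (fun s => a • γ₀' s + b • γ₁' s) +
      a * b * (l / 2 - (T ^ 2 * cf + T * cg)) * (∫ s in (0 : ℝ)..t, ‖γ₀' s - γ₁' s‖ ^ 2) ≤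
    a * pathCost Λ f g t γ₀ γ₀' + b * pathCost Λ f g t γ₁ γ₁' +
      a * b * (T * cf + cg) * ‖y₀ - y₁‖ ^ 2 := by
  have hd := h₀.ac.sub h₁.ac
  have hm := P.admissible_convex ht.1 h₀ h₁ ha hb hab
  have hrun := P.running_convex ht.1 h₀ h₁ ha hb hab
  set E := ∫ s in (0 : ℝ)..t, ‖γ₀' s - γ₁' s‖ ^ 2 with hE
  have hE0 : 0 ≤ E := intervalIntegral.integral_nonneg ht.1 fun s _ => by positivity
  have hc := P.l_nonneg
  have hab0 : 0 ≤ a * b := mul_nonneg ha hb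
  have hcf := P.cf_nonneg
  have hcg := P.cg_nonneg
  have hrun' : (∫⁻ s in Ioc 0 t, Λ (a • γ₀ s + b • γ₁ s) (a • γ₀' s + b • γ₁' s)).toReal +
      a * b * (l / 2) * E ≤ a * (∫⁻ s in Ioc 0 t, Λ (γ₀ s) (γ₀' s)).toReal +
        b * (∫⁻ s in Ioc 0 t, Λ (γ₁ s) (γ₁' s)).toReal := by
    have h := ENNReal.toReal_mono (ENNReal.add_ne_top.2
      ⟨ENNReal.mul_ne_top ofReal_ne_top h₀.finite,
        ENNReal.mul_ne_top ofReal_ne_top h₁.finite⟩) hrun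
    rwa [ENNReal.toReal_add hm.finite ofReal_ne_top, ENNReal.toReal_ofReal (by positivity),
      ENNReal.toReal_add (ENNReal.mul_ne_top ofReal_ne_top h₀.finite)
        (ENNReal.mul_ne_top ofReal_ne_top h₁.finite), ENNReal.toReal_mul, ENNReal.toReal_mul,
      ENNReal.toReal_ofReal ha, ENNReal.toReal_ofReal hb] at h
  have hdist : ∀ s ∈ Icc 0 t,
      ‖γ₀ s - γ₁ s‖ ^ 2 ≤ 2 * ‖y₀ - y₁‖ ^ 2 + 2 * T * E := by
    intro s hs
    have h := hd.norm_sq_le_terminal hs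
    simp only [h₀.terminal, h₁.terminal, ← hE] at h
    nlinarith [mul_le_mul_of_nonneg_right ht.2 hE0]
  have hpot : ∫ s in (0 : ℝ)..t, f s (a • γ₀ s + b • γ₁ s) ≤
      a * (∫ s in (0 : ℝ)..t, f s (γ₀ s)) + b * (∫ s in (0 : ℝ)..t, f s (γ₁ s)) +
        t * (a * b * (cf / 2) * (2 * ‖y₀ - y₁‖ ^ 2 + 2 * T * E)) := by
    have i₀ := (P.intervalIntegrable_potential h₀.ac le_rfl ht.1 le_rfl).const_mul a
    have i₁ := (P.intervalIntegrable_potential h₁.ac le_rfl ht.1 le_rfl).const_mul b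
    have h : ∫ s in (0 : ℝ)..t, f s (a • γ₀ s + b • γ₁ s) ≤
        ∫ s in (0 : ℝ)..t, (a * f s (γ₀ s) + b * f s (γ₁ s) +
          a * b * (cf / 2) * (2 * ‖y₀ - y₁‖ ^ 2 + 2 * T * E)) := by
      refine intervalIntegral.integral_mono_on ht.1
        (P.intervalIntegrable_potential hm.ac le_rfl ht.1 le_rfl)
        ((i₀.add i₁).add (by simp)) fun s hs => ?_
      refine (P.potential_semiconvex s _ _ a b ha hb hab).trans ?_
      have := hdist s hs
      gcongr
    rw [intervalIntegral.integral_add (i₀.add i₁) (by simp), intervalIntegral.integral_add i₀ i₁,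
      intervalIntegral.integral_const_mul, intervalIntegral.integral_const_mul,
      intervalIntegral.integral_const, smul_eq_mul, sub_zero] at h
    exact h
  have hini := P.initial_semiconvex (γ₀ 0) (γ₁ 0) a b ha hb hab
  have hini' := mul_le_mul_of_nonneg_left (hdist 0 ⟨le_rfl, ht.1⟩)
    (show 0 ≤ a * b * (cg / 2) by positivity)
  have hT0 := P.T_nonneg
  have hpot' : t * (a * b * (cf / 2) * (2 * ‖y₀ - y₁‖ ^ 2 + 2 * T * E)) ≤
      T * (a * b * (cf / 2) * (2 * ‖y₀ - y₁‖ ^ 2 + 2 * T * E)) :=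
    mul_le_mul_of_nonneg_right ht.2 (by positivity)
  unfold pathCost
  linarith

theorem le_pathCost (P : IsConvexProblem Λ f g T l cf cg K m) (ht : t ∈ Icc 0 T)
    (h : IsAC2 t γ γ') : -(T + 1) * |m| ≤ pathCost Λ f g t γ γ' := by
  have h1 : ∫ _s in (0 : ℝ)..t, m ≤ ∫ s in (0 : ℝ)..t, f s (γ s) :=
    intervalIntegral.integral_mono_on ht.1 (by simp)
      (P.intervalIntegrable_potential h le_rfl ht.1 le_rfl) fun s _ => P.potential_ge s _
  rw [intervalIntegral.integral_const, smul_eq_mul, sub_zero] at h1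
  have h2 := P.initial_ge (γ 0)
  have h3 : 0 ≤ (∫⁻ s in Ioc 0 t, Λ (γ s) (γ' s)).toReal := ENNReal.toReal_nonneg
  have h4 := neg_abs_le m
  unfold pathCost
  nlinarith [mul_le_mul_of_nonneg_right ht.2 (abs_nonneg m),
    mul_le_mul_of_nonneg_left h4 ht.1]

theorem admissible_const (P : IsConvexProblem Λ f g T l cf cg K m) (t : ℝ) (y : V) :
    IsAdmissiblePath Λ t y (fun _ => y) (fun _ => 0) :=
  ⟨IsAC2.const t y, rfl, by
    simp only [lintegral_const]
    exact ENNReal.mul_ne_top (P.rest_finite y) (by simp)⟩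

/-- The midpoint of two minimizers is a competitor, so the convexity gain must vanish. The
velocities then agree in L², and the common terminal value identifies the paths. -/
theorem eqOn_of_minimizers (P : IsConvexProblem Λ f g T l cf cg K m) (ht : t ∈ Icc 0 T)
    (h₀ : IsAdmissiblePath Λ t y γ₀ γ₀') (h₁ : IsAdmissiblePath Λ t y γ₁ γ₁')
    (m₀ : ∀ η η', IsAdmissiblePath Λ t y η η' → pathCost Λ f g t γ₀ γ₀' ≤ pathCost Λ f g t η η')
    (m₁ : ∀ η η', IsAdmissiblePath Λ t y η η' → pathCost Λ f g t γ₁ γ₁' ≤ pathCost Λ f g t η η') :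
    EqOn γ₀ γ₁ (Icc 0 t) := by
  have hc := P.pathCost_convex ht h₀ h₁ (a := 1 / 2) (b := 1 / 2) (by norm_num) (by norm_num)
    (by norm_num)
  have hadm := P.admissible_convex ht.1 h₀ h₁ (a := 1 / 2) (b := 1 / 2) (by norm_num)
    (by norm_num) (by norm_num)
  rw [← add_smul] at hadm
  norm_num at hadm
  have e₀ := m₀ _ _ hadm
  have e₁ := m₁ _ _ hadm
  have hs := P.small
  norm_num at hc e₀ e₁
  set E := ∫ s in (0 : ℝ)..t, ‖γ₀' s - γ₁' s‖ ^ 2 with hE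
  have hE0 : 0 ≤ E := intervalIntegral.integral_nonneg ht.1 fun s _ => by positivity
  have hE1 : E ≤ 0 := by nlinarith
  intro s hs
  have h := (h₀.ac.sub h₁.ac).norm_sq_le_terminal hs
  simp only [h₀.terminal, h₁.terminal, ← hE, le_antisymm hE1 hE0, sub_self, norm_zero] at h
  have h' : ‖γ₀ s - γ₁ s‖ ^ 2 ≤ 0 := by linarith
  exact sub_eq_zero.1 (norm_eq_zero.1 (pow_eq_zero_iff two_ne_zero |>.1
    (le_antisymm h' (sq_nonneg ‖γ₀ s - γ₁ s‖))))

end IsConvexProblem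

end ConvexProblem

/-! ### Existence of minimizers. -/

section Existence

theorem Lp_two_norm_sq_eq_integral {α : Type*} {mα : MeasurableSpace α} {μ : Measure α}
    {V : Type*} [NormedAddCommGroup V] (X : Lp V 2 μ) : ‖X‖ ^ 2 = ∫ ω, ‖X ω‖ ^ 2 ∂μ := by
  have h0 : 0 ≤ ∫ ω, ‖X ω‖ ^ 2 ∂μ := integral_nonneg fun _ => by positivity
  rw [Lp.norm_def, (Lp.memLp X).eLpNorm_eq_integral_rpow_norm two_ne_zero ofNat_ne_top]
  simp only [ENNReal.toReal_ofNat, Real.rpow_two]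
  rw [ENNReal.toReal_ofReal (by positivity), ← Real.rpow_natCast, ← Real.rpow_mul h0]
  norm_num

theorem dist_toLp_sq {α : Type*} {mα : MeasurableSpace α} {μ : Measure α}
    {V : Type*} [NormedAddCommGroup V] {u w : α → V} (hu : MemLp u 2 μ) (hw : MemLp w 2 μ) :
    dist (hu.toLp u) (hw.toLp w) ^ 2 = ∫ ω, ‖u ω - w ω‖ ^ 2 ∂μ := by
  rw [dist_eq_norm, ← MemLp.toLp_sub, Lp_two_norm_sq_eq_integral]
  refine integral_congr_ae ?_
  filter_upwards [(hu.sub hw).coeFn_toLp] with ω h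
  rw [h, Pi.sub_apply]

namespace IsConvexProblem

variable {V : Type*} [NormedAddCommGroup V] [NormedSpace ℝ V]
  {Λ : V → V → ℝ≥0∞} {f : ℝ → V → ℝ} {g : V → ℝ} {T l cf cg K m : ℝ} {t : ℝ}

/-- Lower semicontinuity of the cost along a sequence of paths with converging velocities. -/
theorem pathCost_le_of_tendsto [CompleteSpace V]
    (P : IsConvexProblem Λ f g T l cf cg K m) (ht : t ∈ Icc 0 T)
    {y : V} {γ γ' : ℕ → ℝ → V} (hadm : ∀ n, IsAdmissiblePath Λ t y (γ n) (γ' n))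
    {η η' : ℝ → V} (hη : IsAC2 t η η') (hy : η t = y)
    (hlim : Tendsto (fun n => ∫ s in (0 : ℝ)..t, ‖γ' n s - η' s‖ ^ 2) atTop (𝓝 0))
    {S : ℝ} (hS : Tendsto (fun n => pathCost Λ f g t (γ n) (γ' n)) atTop (𝓝 S)) :
    IsAdmissiblePath Λ t y η η' ∧ pathCost Λ f g t η η' ≤ S := by
  set e : ℕ → ℝ := fun n => √(2 * t * ∫ s in (0 : ℝ)..t, ‖γ' n s - η' s‖ ^ 2) with he
  have he0 : Tendsto e atTop (𝓝 0) := by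
    have := (hlim.const_mul (2 * t)).sqrt
    simpa using this
  have hdist : ∀ n, ∀ s ∈ Icc 0 t, ‖γ n s - η s‖ ≤ e n := by
    intro n s hs
    have h := ((hadm n).ac.sub hη).norm_sq_le_terminal hs
    simp only [(hadm n).terminal, hy, sub_self, norm_zero] at h
    refine Real.le_sqrt_of_sq_le ?_
    linarith
  have hptw : ∀ s ∈ Icc 0 t, Tendsto (fun n => γ n s) atTop (𝓝 (η s)) := fun s hs =>
    tendsto_iff_norm_sub_tendsto_zero.2
      (squeeze_zero (fun _ => norm_nonneg _) (fun n => hdist n s hs) he0)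
  have hpot : Tendsto (fun n => ∫ s in (0 : ℝ)..t, f s (γ n s)) atTop
      (𝓝 (∫ s in (0 : ℝ)..t, f s (η s))) := by
    refine tendsto_iff_norm_sub_tendsto_zero.2
      (squeeze_zero (fun _ => norm_nonneg _) (fun n => ?_)
        (show Tendsto (fun n => K * e n * |t - 0|) atTop (𝓝 0) by
          simpa using (he0.const_mul K).mul_const |t - 0|))
    rw [← intervalIntegral.integral_sub
      (P.intervalIntegrable_potential (hadm n).ac le_rfl ht.1 le_rfl)
      (P.intervalIntegrable_potential hη le_rfl ht.1 le_rfl)]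
    refine intervalIntegral.norm_integral_le_of_norm_le_const fun s hs => ?_
    rw [uIoc_of_le ht.1] at hs
    rw [Real.norm_eq_abs]
    exact (P.potential_lip s _ _).trans
      (mul_le_mul_of_nonneg_left (hdist n s ⟨hs.1.le, hs.2⟩) P.K_nonneg)
  have hini : Tendsto (fun n => g (γ n 0)) atTop (𝓝 (g (η 0))) :=
    (P.initial_cont.tendsto _).comp (hptw 0 ⟨le_rfl, ht.1⟩)
  -- Convergence of the actions is not assumed: it is recovered as the limit of the costs minus the
  -- limits of the other two terms.
  have hact : Tendsto (fun n => (∫⁻ s in Ioc 0 t, Λ (γ n s) (γ' n s)).toReal) atTop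
      (𝓝 (S - (∫ s in (0 : ℝ)..t, f s (η s)) - g (η 0))) := by
    refine ((hS.sub hpot).sub hini).congr fun n => ?_
    unfold pathCost
    ring
  have hpos : 0 ≤ S - (∫ s in (0 : ℝ)..t, f s (η s)) - g (η 0) :=
    ge_of_tendsto' hact fun _ => ENNReal.toReal_nonneg
  have hact' : Tendsto (fun n => ∫⁻ s in Ioc 0 t, Λ (γ n s) (γ' n s)) atTop
      (𝓝 (ENNReal.ofReal (S - (∫ s in (0 : ℝ)..t, f s (η s)) - g (η 0)))) := by
    refine ((ENNReal.continuous_ofReal.tendsto _).comp hact).congr fun n => ?_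
    exact ENNReal.ofReal_toReal (hadm n).finite
  have hLp : Tendsto (fun n => (hadm n).ac.1.toLp (γ' n)) atTop (𝓝 (hη.1.toLp η')) := by
    rw [tendsto_iff_dist_tendsto_zero]
    have := hlim.sqrt
    rw [Real.sqrt_zero] at this
    refine this.congr fun n => ?_
    rw [intervalIntegral.integral_of_le ht.1, ← dist_toLp_sq (hadm n).ac.1 hη.1,
      Real.sqrt_sq dist_nonneg]
  -- Along a subsequence the velocities converge almost everywhere, and the positions converge
  -- everywhere. Lower semicontinuity of the Lagrangian and Fatou's lemma then apply.
  obtain ⟨ns, hns, hae⟩ := (tendstoInMeasure_of_tendsto_Lp hLp).exists_seq_tendsto_ae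
  have hcoe : ∀ᵐ s ∂volume.restrict (Ioc 0 t), ∀ n, (hadm n).ac.1.toLp (γ' n) s = γ' n s :=
    ae_all_iff.2 fun n => (hadm n).ac.1.coeFn_toLp
  have hfatou : ∫⁻ s in Ioc 0 t, Λ (η s) (η' s) ≤
      ENNReal.ofReal (S - (∫ s in (0 : ℝ)..t, f s (η s)) - g (η 0)) := by
    calc ∫⁻ s in Ioc 0 t, Λ (η s) (η' s)
        ≤ ∫⁻ s in Ioc 0 t, liminf (fun i => Λ (γ (ns i) s) (γ' (ns i) s)) atTop := by
          refine lintegral_mono_ae ?_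
          filter_upwards [hae, hcoe, hη.1.coeFn_toLp,
            ae_restrict_mem measurableSet_Ioc] with s h1 h2 h3 h4
          have h5 : Tendsto (fun i => (γ (ns i) s, γ' (ns i) s)) atTop (𝓝 (η s, η' s)) := by
            refine ((hptw s ⟨h4.1.le, h4.2⟩).comp hns.tendsto_atTop).prodMk_nhds ?_
            simpa only [h2, h3] using h1
          exact (LowerSemicontinuousAt.le_liminf (P.lsc (η s, η' s))).trans
            (liminf_le_liminf_of_le h5)
      _ ≤ liminf (fun i => ∫⁻ s in Ioc 0 t, Λ (γ (ns i) s) (γ' (ns i) s)) atTop :=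
          lintegral_liminf_le' fun i => P.aemeasurable_running (hadm (ns i)).ac
      _ = _ := (hact'.comp hns.tendsto_atTop).liminf_eq
  refine ⟨⟨hη, hy, ne_top_of_le_ne_top ofReal_ne_top hfatou⟩, ?_⟩
  have := ENNReal.toReal_le_of_le_ofReal hpos hfatou
  unfold pathCost
  linarith

/-- Strong convexity makes the velocities of a minimizing sequence Cauchy in L², so strong limits
suffice and no weak compactness is used. The limit path is rebuilt from its velocity and the
terminal value. -/
theorem exists_minimizer [CompleteSpace V] (P : IsConvexProblem Λ f g T l cf cg K m)
    (ht : t ∈ Icc 0 T) (y : V) :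
    ∃ γ γ', IsAdmissiblePath Λ t y γ γ' ∧ ∀ η η', IsAdmissiblePath Λ t y η η' →
      pathCost Λ f g t γ γ' ≤ pathCost Λ f g t η η' := by
  set costs : Set ℝ := {c | ∃ η η', IsAdmissiblePath Λ t y η η' ∧ c = pathCost Λ f g t η η'}
    with hcosts
  have hne : costs.Nonempty := ⟨_, _, _, P.admissible_const t y, rfl⟩
  have hbdd : BddBelow costs := ⟨_, by
    rintro _ ⟨η, η', h, rfl⟩
    exact P.le_pathCost ht h.ac⟩
  set S := sInf costs
  have hS : ∀ η η', IsAdmissiblePath Λ t y η η' → S ≤ pathCost Λ f g t η η' :=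
    fun η η' h => csInf_le hbdd ⟨η, η', h, rfl⟩
  have hex : ∀ n : ℕ, ∃ γ γ', IsAdmissiblePath Λ t y γ γ' ∧
      pathCost Λ f g t γ γ' < S + 1 / ((n : ℝ) + 1) := by
    intro n
    obtain ⟨_, ⟨η, η', h, rfl⟩, hlt⟩ :=
      exists_lt_of_csInf_lt hne (lt_add_of_pos_right S (Nat.one_div_pos_of_nat (α := ℝ) (n := n)))
    exact ⟨η, η', h, hlt⟩
  choose γ γ' hadm hlt using hex
  have hsmall := P.small
  set κ := l / 2 - (T ^ 2 * cf + T * cg) with hκ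
  have hκ0 : 0 < κ := by rw [hκ]; linarith
  -- The midpoint costs at least S and both endpoints less than S + 1/(N+1), so (κ/4)E ≤ 1/(N+1).
  have hE : ∀ N n k : ℕ, N ≤ n → N ≤ k →
      ∫ s in (0 : ℝ)..t, ‖γ' n s - γ' k s‖ ^ 2 ≤ 4 / κ * (1 / ((N : ℝ) + 1)) := by
    intro N n k hn hk
    have hc := P.pathCost_convex ht (hadm n) (hadm k) (a := 1 / 2) (b := 1 / 2) (by norm_num)
      (by norm_num) (by norm_num)
    have had := P.admissible_convex ht.1 (hadm n) (hadm k) (a := 1 / 2) (b := 1 / 2)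
      (by norm_num) (by norm_num) (by norm_num)
    rw [← add_smul, show (1 / 2 + 1 / 2 : ℝ) = 1 by norm_num, one_smul] at had
    have h1 := hS _ _ had
    have h2 := hlt n
    have h3 := hlt k
    have h4 : 1 / ((n : ℝ) + 1) ≤ 1 / ((N : ℝ) + 1) := by gcongr
    have h5 : 1 / ((k : ℝ) + 1) ≤ 1 / ((N : ℝ) + 1) := by gcongr
    rw [← hκ, sub_self, norm_zero] at hc
    rw [div_mul_eq_mul_div, le_div_iff₀ hκ0]
    nlinarith
  have hdist : ∀ n k N : ℕ, N ≤ n → N ≤ k →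
      dist ((hadm n).ac.1.toLp (γ' n)) ((hadm k).ac.1.toLp (γ' k)) ≤
        √(4 / κ * (1 / ((N : ℝ) + 1))) := by
    intro n k N hn hk
    refine Real.le_sqrt_of_sq_le ?_
    rw [dist_toLp_sq, ← intervalIntegral.integral_of_le ht.1]
    exact hE N n k hn hk
  have hcauchy : CauchySeq fun n => (hadm n).ac.1.toLp (γ' n) := by
    refine cauchySeq_of_le_tendsto_0 _ hdist ?_
    have := (tendsto_one_div_add_atTop_nhds_zero_nat (𝕜 := ℝ)).const_mul (4 / κ)
    simpa using this.sqrt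
  obtain ⟨w, hw⟩ := cauchySeq_tendsto_of_complete hcauchy
  have hlim : Tendsto (fun n => ∫ s in (0 : ℝ)..t, ‖γ' n s - w s‖ ^ 2) atTop (𝓝 0) := by
    have h := (tendsto_iff_dist_tendsto_zero.1 hw).pow 2
    rw [zero_pow two_ne_zero] at h
    refine h.congr fun n => ?_
    rw [intervalIntegral.integral_of_le ht.1, ← dist_toLp_sq (hadm n).ac.1 (Lp.memLp w),
      Lp.toLp_coeFn]
  have hcost : Tendsto (fun n => pathCost Λ f g t (γ n) (γ' n)) atTop (𝓝 S) := by
    refine tendsto_of_tendsto_of_tendsto_of_le_of_le tendsto_const_nhds ?_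
      (fun n => hS _ _ (hadm n)) (fun n => (hlt n).le)
    simpa using (tendsto_one_div_add_atTop_nhds_zero_nat (𝕜 := ℝ)).const_add S
  obtain ⟨hη, hle⟩ := P.pathCost_le_of_tendsto ht hadm
    (IsAC2.of_velocity y (Lp.memLp w)) (by simp) hlim hcost
  exact ⟨_, _, hη, fun η η' h => hle.trans (hS η η' h)⟩

end IsConvexProblem

end Existence

/-! ### Dynamic programming -/

section DynamicProgramming

variable {V : Type*} [NormedAddCommGroup V] [NormedSpace ℝ V]
  {Λ : V → V → ℝ≥0∞} {f : ℝ → V → ℝ} {g : V → ℝ} {T l cf cg K m : ℝ} {s t : ℝ} {x y : V}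
  {γ γ' η η' : ℝ → V}

theorem lintegral_action_split {φ : ℝ → ℝ≥0∞} (h0 : 0 ≤ s) (hst : s ≤ t) :
    ∫⁻ τ in Ioc 0 t, φ τ = (∫⁻ τ in Ioc 0 s, φ τ) + ∫⁻ τ in Ioc s t, φ τ := by
  rw [← Ioc_union_Ioc_eq_Ioc h0 hst, lintegral_union measurableSet_Ioc]
  exact Ioc_disjoint_Ioc_of_le le_rfl

namespace IsConvexProblem

theorem pathCost_split (P : IsConvexProblem Λ f g T l cf cg K m)
    (h : IsAdmissiblePath Λ t y γ γ') (h0 : 0 ≤ s) (hst : s ≤ t) :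
    pathCost Λ f g t γ γ' = pathCost Λ f g s γ γ' +
      ((∫⁻ τ in Ioc s t, Λ (γ τ) (γ' τ)).toReal + ∫ τ in s..t, f τ (γ τ)) := by
  unfold pathCost
  rw [lintegral_action_split h0 hst, ENNReal.toReal_add (h.truncate hst).finite
    (h.finite_subset (Ioc_subset_Ioc_left h0)),
    ← intervalIntegral.integral_add_adjacent_intervals
      (P.intervalIntegrable_potential h.ac le_rfl h0 hst)
      (P.intervalIntegrable_potential h.ac h0 hst le_rfl)]
  ring

/-- Only the part of γ after s needs finite action, so the tail can be any convenient path, for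
instance a straight line. -/
theorem admissible_concat (P : IsConvexProblem Λ f g T l cf cg K m) (h0 : 0 ≤ s) (hst : s ≤ t)
    (hη : IsAdmissiblePath Λ s (γ s) η η') (hγ : IsAC2 t γ γ')
    (hfin : ∫⁻ τ in Ioc s t, Λ (γ τ) (γ' τ) ≠ ∞) :
    IsAdmissiblePath Λ t (γ t) ((Iic s).piecewise η γ) ((Iic s).piecewise η' γ') ∧
    pathCost Λ f g t ((Iic s).piecewise η γ) ((Iic s).piecewise η' γ') =
      pathCost Λ f g s η η' +
      ((∫⁻ τ in Ioc s t, Λ (γ τ) (γ' τ)).toReal + ∫ τ in s..t, f τ (γ τ)) := by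
  have hleft : ∀ τ ≤ s, (Iic s).piecewise η γ τ = η τ ∧ (Iic s).piecewise η' γ' τ = η' τ :=
    fun τ hτ => ⟨piecewise_eq_of_mem _ _ _ hτ, piecewise_eq_of_mem _ _ _ hτ⟩
  have hright : ∀ τ, s < τ →
      (Iic s).piecewise η γ τ = γ τ ∧ (Iic s).piecewise η' γ' τ = γ' τ := fun τ hτ =>
    ⟨piecewise_eq_of_notMem _ _ _ (not_le.2 hτ), piecewise_eq_of_notMem _ _ _ (not_le.2 hτ)⟩
  have e1 : ∫⁻ τ in Ioc 0 s, Λ ((Iic s).piecewise η γ τ) ((Iic s).piecewise η' γ' τ) =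
      ∫⁻ τ in Ioc 0 s, Λ (η τ) (η' τ) :=
    setLIntegral_congr_fun measurableSet_Ioc fun τ hτ => by
      rw [(hleft τ hτ.2).1, (hleft τ hτ.2).2]
  have e2 : ∫⁻ τ in Ioc s t, Λ ((Iic s).piecewise η γ τ) ((Iic s).piecewise η' γ' τ) =
      ∫⁻ τ in Ioc s t, Λ (γ τ) (γ' τ) :=
    setLIntegral_congr_fun measurableSet_Ioc fun τ hτ => by
      rw [(hright τ hτ.1).1, (hright τ hτ.1).2]
  have hadm : IsAdmissiblePath Λ t (γ t) ((Iic s).piecewise η γ)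
      ((Iic s).piecewise η' γ') := by
    refine ⟨hη.ac.concat h0 hst hγ hη.terminal, ?_, ?_⟩
    · rcases hst.eq_or_lt with rfl | hlt
      · rw [(hleft s le_rfl).1, hη.terminal]
      · exact (hright t hlt).1
    · rw [lintegral_action_split h0 hst, e1, e2]
      exact ENNReal.add_ne_top.2 ⟨hη.finite, hfin⟩
  refine ⟨hadm, ?_⟩
  rw [P.pathCost_split hadm h0 hst, e2]
  congr 1
  · unfold pathCost
    rw [e1, (hleft 0 h0).1]
    congr 2
    refine intervalIntegral.integral_congr fun τ hτ => ?_
    rw [uIcc_of_le h0] at hτ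
    simp only [(hleft τ hτ.2).1]
  · congr 1
    refine intervalIntegral.integral_congr_ae (Eventually.of_forall fun τ hτ => ?_)
    rw [uIoc_of_le hst] at hτ
    rw [(hright τ hτ.1).1]

/-- A cheaper path on [0,s] could be glued to the remaining part of γ, contradicting its minimality
on [0,t]. -/
theorem minimizer_truncate (P : IsConvexProblem Λ f g T l cf cg K m)
    (h : IsAdmissiblePath Λ t y γ γ')
    (hmin : ∀ η η', IsAdmissiblePath Λ t y η η' → pathCost Λ f g t γ γ' ≤ pathCost Λ f g t η η')
    (h0 : 0 ≤ s) (hst : s ≤ t) (hη : IsAdmissiblePath Λ s (γ s) η η') :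
    pathCost Λ f g s γ γ' ≤ pathCost Λ f g s η η' := by
  obtain ⟨hadm, hcost⟩ := P.admissible_concat h0 hst hη h.ac
    (h.finite_subset (Ioc_subset_Ioc_left h0))
  have h1 := hmin _ _ (h.terminal ▸ hadm)
  rw [hcost, P.pathCost_split h h0 hst] at h1
  linarith

end IsConvexProblem

/-- The least cost of an admissible path with terminal value `y`. -/
noncomputable def valueFunction (Λ : V → V → ℝ≥0∞) (f : ℝ → V → ℝ) (g : V → ℝ) (t : ℝ)
    (y : V) : ℝ :=
  sInf {c | ∃ r r', IsAdmissiblePath Λ t y r r' ∧ c = pathCost Λ f g t r r'}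

namespace IsConvexProblem

theorem value_le (P : IsConvexProblem Λ f g T l cf cg K m) (ht : t ∈ Icc 0 T)
    (h : IsAdmissiblePath Λ t y γ γ') : valueFunction Λ f g t y ≤ pathCost Λ f g t γ γ' :=
  csInf_le ⟨_, by
    rintro _ ⟨η, η', k, rfl⟩
    exact P.le_pathCost ht k.ac⟩ ⟨γ, γ', h, rfl⟩

/-- One half of dynamic programming: the initial piece of an optimal path competes in the shorter
problem. -/
theorem value_ge_restrict (P : IsConvexProblem Λ f g T l cf cg K m) (h0 : 0 ≤ s) (hst : s ≤ t)
    (ht : t ≤ T) (h : IsAdmissiblePath Λ t y γ γ')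
    (hval : valueFunction Λ f g t y = pathCost Λ f g t γ γ') :
    valueFunction Λ f g s (γ s) +
      ((∫⁻ τ in Ioc s t, Λ (γ τ) (γ' τ)).toReal + ∫ τ in s..t, f τ (γ τ)) ≤
    valueFunction Λ f g t y := by
  rw [hval, P.pathCost_split h h0 hst]
  gcongr
  exact P.value_le ⟨h0, hst.trans ht⟩ (h.truncate hst)

variable [CompleteSpace V]

theorem exists_value_eq (P : IsConvexProblem Λ f g T l cf cg K m) (ht : t ∈ Icc 0 T) (y : V) :
    ∃ r r', IsAdmissiblePath Λ t y r r' ∧ valueFunction Λ f g t y = pathCost Λ f g t r r' := by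
  obtain ⟨r, r', h, hmin⟩ := P.exists_minimizer ht y
  refine ⟨r, r', h, le_antisymm (P.value_le ht h) (le_csInf ⟨_, r, r', h, rfl⟩ ?_)⟩
  rintro _ ⟨η, η', k, rfl⟩
  exact hmin η η' k

/-- The other half of dynamic programming: an optimal path up to s, continued along γ, competes in
the longer problem. -/
theorem value_le_extend (P : IsConvexProblem Λ f g T l cf cg K m) (h0 : 0 ≤ s) (hst : s ≤ t)
    (ht : t ≤ T) (hγ : IsAC2 t γ γ') (hfin : ∫⁻ τ in Ioc s t, Λ (γ τ) (γ' τ) ≠ ∞) :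
    valueFunction Λ f g t (γ t) ≤ valueFunction Λ f g s (γ s) +
      ((∫⁻ τ in Ioc s t, Λ (γ τ) (γ' τ)).toReal + ∫ τ in s..t, f τ (γ τ)) := by
  obtain ⟨η, η', h, hval⟩ := P.exists_value_eq ⟨h0, hst.trans ht⟩ (γ s)
  obtain ⟨hadm, hcost⟩ := P.admissible_concat h0 hst h hγ hfin
  rw [hval, ← hcost]
  exact P.value_le ⟨h0.trans hst, ht⟩ hadm

/-- The convex combination of minimizers for x and y competes at the combined endpoint; the kinetic
term in `pathCost_convex` has a favourable sign and is dropped. -/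
theorem value_semiconvex (P : IsConvexProblem Λ f g T l cf cg K m) (ht : t ∈ Icc 0 T) (x y : V)
    {a b : ℝ} (ha : 0 ≤ a) (hb : 0 ≤ b) (hab : a + b = 1) :
    valueFunction Λ f g t (a • x + b • y) ≤ a * valueFunction Λ f g t x +
      b * valueFunction Λ f g t y + a * b * (T * cf + cg) * ‖x - y‖ ^ 2 := by
  obtain ⟨γ, γ', h, hval⟩ := P.exists_value_eq ht x
  obtain ⟨η, η', k, hval'⟩ := P.exists_value_eq ht y
  rw [hval, hval']
  refine (P.value_le ht (P.admissible_convex ht.1 h k ha hb hab)).trans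
    (le_trans ?_ (P.pathCost_convex ht h k ha hb hab))
  refine le_add_of_nonneg_right ?_
  have h1 := P.small
  have h2 : 0 ≤ ∫ s in (0 : ℝ)..t, ‖γ' s - η' s‖ ^ 2 :=
    intervalIntegral.integral_nonneg ht.1 fun s _ => by positivity
  have h3 : 0 ≤ l / 2 - (T ^ 2 * cf + T * cg) := by linarith
  positivity

theorem value_zero (P : IsConvexProblem Λ f g T l cf cg K m) (y : V) :
    valueFunction Λ f g 0 y = g y := by
  obtain ⟨γ, γ', h, hval⟩ := P.exists_value_eq ⟨le_rfl, P.T_nonneg⟩ y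
  rw [hval]
  simp [pathCost, h.terminal]

end IsConvexProblem

end DynamicProgramming

/-! ### Regularity of the value function -/

section Regularity

variable {E : Type*} [NormedAddCommGroup E] [InnerProductSpace ℝ E]

/-- A strongly convex problem with a real-valued, coercive, continuously differentiable Lagrangian
`L` (with `x`-derivative `L₁`) and a continuously differentiable potential `f` (with derivative
`f₁`). -/
structure IsRegularProblem (L : E → E → ℝ) (L₁ : E → E → E →L[ℝ] ℝ) (f : ℝ → E → ℝ)
    (f₁ : ℝ → E → E →L[ℝ] ℝ) (g : E → ℝ) (T l cf cg K m c₀ c₁ : ℝ) : Prop extends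
    IsConvexProblem (fun x v => ENNReal.ofReal (L x v)) f g T l cf cg K m where
  L_cont : Continuous (Function.uncurry L)
  L_nonneg : ∀ x v, 0 ≤ L x v
  c₀_pos : 0 < c₀
  c₁_nonneg : 0 ≤ c₁
  L_ge : ∀ x v, c₀ * ‖v‖ ^ 2 ≤ L x v
  L_deriv : ∀ x v, HasFDerivAt (fun z => L z v) (L₁ x v) x
  L_deriv_cont : Continuous (Function.uncurry L₁)
  L_deriv_le : ∀ x v, ‖L₁ x v‖ ≤ c₁
  f_deriv : ∀ s x, HasFDerivAt (f s) (f₁ s x) x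
  f_deriv_cont : Continuous (Function.uncurry f₁)
  f_deriv_le : ∀ s x, ‖f₁ s x‖ ≤ K
  g_diff : Differentiable ℝ g

/-- A semiconvex function touched from above by a differentiable function is differentiable. -/
theorem hasFDerivAt_of_touching {u w : E → ℝ} {w' : E →L[ℝ] ℝ} {q : E} {C : ℝ}
    (hu : ∀ x y : E, ∀ a b : ℝ, 0 ≤ a → 0 ≤ b → a + b = 1 →
      u (a • x + b • y) ≤ a * u x + b * u y + a * b * C * ‖x - y‖ ^ 2)
    (hw : HasFDerivAt w w' 0) (hle : ∀ h, u (q + h) ≤ w h) (heq : u q = w 0) :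
    HasFDerivAt u w' q := by
  rw [hasFDerivAt_iff_isLittleO_nhds_zero, Asymptotics.isLittleO_iff] at hw ⊢
  intro ε hε
  have h1 := hw (half_pos hε)
  have h2 : ∀ᶠ h in 𝓝 (0 : E), ‖w (0 + -h) - w 0 - w' (-h)‖ ≤ ε / 2 * ‖-h‖ := by
    have : Tendsto (fun h : E => -h) (𝓝 0) (𝓝 0) := by
      simpa using (continuous_neg (G := E)).tendsto 0
    exact this.eventually h1
  have h3 : ∀ᶠ h in 𝓝 (0 : E), 2 * |C| * ‖h‖ < ε / 2 := by
    have : Tendsto (fun h : E => 2 * |C| * ‖h‖) (𝓝 0) (𝓝 0) := by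
      simpa using (continuous_norm.tendsto (0 : E)).const_mul (2 * |C|)
    exact this.eventually_lt_const (half_pos hε)
  filter_upwards [h1, h2, h3] with h h1 h2 h3
  rw [zero_add, Real.norm_eq_abs, abs_le] at h1 h2
  rw [norm_neg, map_neg] at h2
  -- Semiconvexity at the midpoint q of q ± h gives u(q + h) ≥ 2u(q) - u(q - h) - 2C‖h‖², so the
  -- upper bound at -h becomes a lower bound at h.
  have h4 := hu (q + h) (q + -h) (1 / 2) (1 / 2) (by norm_num) (by norm_num) (by norm_num)
  have h5 : (1 / 2 : ℝ) • (q + h) + (1 / 2 : ℝ) • (q + -h) = q := by module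
  have h6 : ‖q + h - (q + -h)‖ = 2 * ‖h‖ := by
    rw [show q + h - (q + -h) = (2 : ℝ) • h by module, norm_smul]
    norm_num
  rw [h5, h6] at h4
  have h7 := hle h
  have h8 := hle (-h)
  have h9 : C * ‖h‖ ^ 2 ≤ |C| * ‖h‖ * ‖h‖ := by
    rw [mul_assoc, ← sq]
    exact mul_le_mul_of_nonneg_right (le_abs_self C) (sq_nonneg _)
  have h10 := mul_le_mul_of_nonneg_right h3.le (norm_nonneg h)
  rw [Real.norm_eq_abs, abs_le]
  constructor <;> nlinarith [norm_nonneg h]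

/-- The gradient inequality for semiconvex functions. -/
theorem semiconvex_gradient_inequality [CompleteSpace E] {u : E → ℝ} {C : ℝ}
    (hu : ∀ x y : E, ∀ a b : ℝ, 0 ≤ a → 0 ≤ b → a + b = 1 →
      u (a • x + b • y) ≤ a * u x + b * u y + a * b * C * ‖x - y‖ ^ 2)
    {x : E} (hx : DifferentiableAt ℝ u x) (y : E) :
    u x + inner ℝ (gradient u x) (y - x) - C * ‖y - x‖ ^ 2 ≤ u y := by
  have hd : HasDerivAt (fun b : ℝ => u (x + b • (y - x))) (inner ℝ (gradient u x) (y - x)) 0 := by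
    have h1 : HasFDerivAt u (InnerProductSpace.toDual ℝ E (gradient u x))
        (x + (0 : ℝ) • (y - x)) := by
      simpa using hx.hasGradientAt.hasFDerivAt
    have h2 : HasDerivAt (fun b : ℝ => x + b • (y - x)) (y - x) 0 := by
      simpa using ((hasDerivAt_id (0 : ℝ)).smul_const (y - x)).const_add x
    exact h1.comp_hasDerivAt (0 : ℝ) h2
  have h3 : Tendsto (fun b : ℝ => b⁻¹ * (u (x + b • (y - x)) - u x)) (𝓝[>] 0)
      (𝓝 (inner ℝ (gradient u x) (y - x))) := by
    have := (hasDerivAt_iff_tendsto_slope_zero.1 hd).mono_left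
      (nhdsWithin_mono 0 (show Ioi (0 : ℝ) ⊆ {0}ᶜ from fun b hb => ne_of_gt hb))
    simpa using this
  have h4 : Tendsto (fun b : ℝ => u y - u x + (1 - b) * C * ‖y - x‖ ^ 2) (𝓝[>] 0)
      (𝓝 (u y - u x + (1 - 0) * C * ‖y - x‖ ^ 2)) := by
    refine Tendsto.mono_left (Continuous.tendsto ?_ 0) nhdsWithin_le_nhds
    fun_prop
  have h5 : ∀ᶠ b : ℝ in 𝓝[>] 0, b⁻¹ * (u (x + b • (y - x)) - u x) ≤
      u y - u x + (1 - b) * C * ‖y - x‖ ^ 2 := by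
    filter_upwards [Ioo_mem_nhdsGT (show (0 : ℝ) < 1 by norm_num)] with b hb
    have h6 := hu x y (1 - b) b (by linarith [hb.2]) hb.1.le (by ring)
    rw [show (1 - b) • x + b • y = x + b • (y - x) by module, norm_sub_rev x y] at h6
    rw [inv_mul_le_iff₀ hb.1]
    linarith
  have := le_of_tendsto_of_tendsto h3 h4 h5
  linarith

namespace IsRegularProblem

variable {L : E → E → ℝ} {L₁ : E → E → E →L[ℝ] ℝ} {f : ℝ → E → ℝ} {f₁ : ℝ → E → E →L[ℝ] ℝ}
  {g : E → ℝ} {T l cf cg K m c₀ c₁ : ℝ} {s t : ℝ} {x y q : E} {r r' : ℝ → E}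

theorem L_lip (P : IsRegularProblem L L₁ f f₁ g T l cf cg K m c₀ c₁) (x y v : E) :
    |L x v - L y v| ≤ c₁ * ‖x - y‖ := by
  have := Convex.norm_image_sub_le_of_norm_hasFDerivWithin_le (𝕜 := ℝ) (f := fun z => L z v)
    (fun z _ => (P.L_deriv z v).hasFDerivWithinAt) (fun z _ => P.L_deriv_le z v) convex_univ
    (mem_univ y) (mem_univ x)
  simpa using this

theorem integrable_running (P : IsRegularProblem L L₁ f f₁ g T l cf cg K m c₀ c₁)
    (h : IsAdmissiblePath (fun x v => ENNReal.ofReal (L x v)) t y r r') {A : Set ℝ}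
    (hA : A ⊆ Ioc 0 t) :
    IntegrableOn (fun τ => L (r τ) (r' τ)) A := by
  have hm : AEStronglyMeasurable (fun τ => L (r τ) (r' τ)) (volume.restrict (Ioc 0 t)) :=
    P.L_cont.comp_aestronglyMeasurable (h.ac.aestronglyMeasurable.prodMk h.ac.1.1)
  refine ⟨hm.mono_measure (Measure.restrict_mono hA le_rfl), ?_⟩
  rw [hasFiniteIntegral_iff_ofReal (Eventually.of_forall fun τ => P.L_nonneg _ _)]
  exact (h.finite_subset hA).lt_top

theorem toReal_running (P : IsRegularProblem L L₁ f f₁ g T l cf cg K m c₀ c₁)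
    (h : IsAdmissiblePath (fun x v => ENNReal.ofReal (L x v)) t y r r') {A : Set ℝ}
    (hA : A ⊆ Ioc 0 t) :
    (∫⁻ τ in A, ENNReal.ofReal (L (r τ) (r' τ))).toReal = ∫ τ in A, L (r τ) (r' τ) := by
  rw [integral_eq_lintegral_of_nonneg_ae (Eventually.of_forall fun τ => P.L_nonneg _ _)
    (P.integrable_running h hA).1]

/-- Translation keeps the velocity, and L is Lipschitz in position uniformly in the velocity, so no
upper growth bound on L in v is required. -/
theorem admissible_translate (P : IsRegularProblem L L₁ f f₁ g T l cf cg K m c₀ c₁)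
    (h : IsAdmissiblePath (fun x v => ENNReal.ofReal (L x v)) t y r r') (z : E) :
    IsAdmissiblePath (fun x v => ENNReal.ofReal (L x v)) t (y + z) (fun s => r s + z) r' := by
  have hac : IsAC2 t (fun s => r s + z) r' := by
    simpa using h.ac.add (IsAC2.const t z)
  refine ⟨hac, by rw [h.terminal], ?_⟩
  refine ne_top_of_le_ne_top (ENNReal.add_ne_top.2 ⟨h.finite, ?_⟩)
    ((lintegral_mono fun τ => ?_).trans_eq
      (lintegral_add_right (fun τ => ENNReal.ofReal (L (r τ) (r' τ)))
        (measurable_const (a := ENNReal.ofReal (c₁ * ‖z‖)))))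
  · simp only [lintegral_const]
    exact ENNReal.mul_ne_top ofReal_ne_top (by simp)
  · rw [← ENNReal.ofReal_add (P.L_nonneg _ _) (mul_nonneg P.c₁_nonneg (norm_nonneg z))]
    refine ENNReal.ofReal_le_ofReal ?_
    have := (abs_le.1 (P.L_lip (r τ + z) (r τ) (r' τ))).2
    rw [add_sub_cancel_left] at this
    linarith

theorem pathCost_eq (P : IsRegularProblem L L₁ f f₁ g T l cf cg K m c₀ c₁) (ht : 0 ≤ t)
    (h : IsAdmissiblePath (fun x v => ENNReal.ofReal (L x v)) t y r r') :
    pathCost (fun x v => ENNReal.ofReal (L x v)) f g t r r' =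
      (∫ τ in Ioc 0 t, (L (r τ) (r' τ) + f τ (r τ))) + g (r 0) := by
  unfold pathCost
  rw [P.toReal_running h Subset.rfl, intervalIntegral.integral_of_le ht,
    ← integral_add (P.integrable_running h Subset.rfl)
      ((intervalIntegrable_iff_integrableOn_Ioc_of_le ht).1
        (P.intervalIntegrable_potential h.ac le_rfl ht le_rfl))]

/-- The position derivatives of L and f are bounded by c₁ and K uniformly along the path, so the
integral may be differentiated under the sign although the velocity is merely square integrable. -/
theorem hasFDerivAt_translate (P : IsRegularProblem L L₁ f f₁ g T l cf cg K m c₀ c₁)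
    (ht : 0 ≤ t) (h : IsAdmissiblePath (fun x v => ENNReal.ofReal (L x v)) t y r r') :
    ∃ w' : E →L[ℝ] ℝ, HasFDerivAt (fun z => pathCost (fun x v => ENNReal.ofReal (L x v)) f g t
      (fun s => r s + z) r') w' 0 := by
  have hmeas := h.ac.aestronglyMeasurable
  have hmeas' := h.ac.1.1
  have hrun : HasFDerivAt (fun z => ∫ τ in Ioc 0 t, (L (r τ + z) (r' τ) + f τ (r τ + z)))
      (∫ τ in Ioc 0 t, (L₁ (r τ + 0) (r' τ) + f₁ τ (r τ + 0))) (0 : E) := by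
    refine hasFDerivAt_integral_of_dominated_of_fderiv_le (s := univ)
      (F' := fun z τ => L₁ (r τ + z) (r' τ) + f₁ τ (r τ + z)) (bound := fun _ => c₁ + K)
      univ_mem (Eventually.of_forall fun z => ?_) ?_ ?_ (Eventually.of_forall fun τ z _ => ?_)
      (by simp) (Eventually.of_forall fun τ z _ => ?_)
    · exact (P.L_cont.comp_aestronglyMeasurable ((hmeas.add_const z).prodMk hmeas')).add
        (P.potential_cont.comp_aestronglyMeasurable
          (aestronglyMeasurable_id.prodMk (hmeas.add_const z)))
    · simp only [add_zero]
      exact (P.integrable_running h Subset.rfl).add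
        ((intervalIntegrable_iff_integrableOn_Ioc_of_le ht).1
          (P.intervalIntegrable_potential h.ac le_rfl ht le_rfl))
    · exact (P.L_deriv_cont.comp_aestronglyMeasurable ((hmeas.add_const 0).prodMk hmeas')).add
        (P.f_deriv_cont.comp_aestronglyMeasurable
          (aestronglyMeasurable_id.prodMk (hmeas.add_const 0)))
    · exact (norm_add_le _ _).trans (add_le_add (P.L_deriv_le _ _) (P.f_deriv_le _ _))
    · exact ((hasFDerivAt_comp_add_left (r τ)).2 (P.L_deriv (r τ + z) (r' τ))).add
        ((hasFDerivAt_comp_add_left (r τ)).2 (P.f_deriv τ (r τ + z)))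
  obtain ⟨g', hg⟩ : ∃ g' : E →L[ℝ] ℝ, HasFDerivAt (fun z => g (r 0 + z)) g' (0 : E) :=
    ⟨_, (P.g_diff.comp (differentiable_id.const_add (r 0)) 0).hasFDerivAt⟩
  refine ⟨_, (hrun.add hg).congr_of_eventuallyEq (Eventually.of_forall fun z => ?_)⟩
  exact P.pathCost_eq ht (P.admissible_translate h z)

variable [CompleteSpace E]

/-- The cost of the translated minimizer touches the semiconvex value function from above at q. -/
theorem differentiable_value (P : IsRegularProblem L L₁ f f₁ g T l cf cg K m c₀ c₁)
    (ht : t ∈ Icc 0 T) (q : E) :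
    DifferentiableAt ℝ (valueFunction (fun x v => ENNReal.ofReal (L x v)) f g t) q := by
  obtain ⟨r, r', h, hval⟩ := P.exists_value_eq ht q
  obtain ⟨w', hw⟩ := P.hasFDerivAt_translate ht.1 h
  refine (hasFDerivAt_of_touching (fun x y _ _ ha hb hab => P.value_semiconvex ht x y ha hb hab)
    hw (fun z => P.value_le ht (P.admissible_translate h z)) ?_).differentiableAt
  simpa using hval

theorem value_gradient_inequality (P : IsRegularProblem L L₁ f f₁ g T l cf cg K m c₀ c₁)
    (ht : t ∈ Icc 0 T) (x y : E) :
    valueFunction (fun x v => ENNReal.ofReal (L x v)) f g t x +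
      inner ℝ (gradient (valueFunction (fun x v => ENNReal.ofReal (L x v)) f g t) x) (y - x) -
      (T * cf + cg) * ‖y - x‖ ^ 2 ≤
    valueFunction (fun x v => ENNReal.ofReal (L x v)) f g t y :=
  semiconvex_gradient_inequality
    (fun x y _ _ ha hb hab => P.value_semiconvex ht x y ha hb hab) (P.differentiable_value ht x) y

/-- Translating a minimizer for x to end at y costs at most T(c₁ + K)‖y - x‖ in the integral and K‖y
- x‖ initially. -/
theorem value_le_add_norm (P : IsRegularProblem L L₁ f f₁ g T l cf cg K m c₀ c₁)
    (ht : t ∈ Icc 0 T) (x y : E) :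
    valueFunction (fun x v => ENNReal.ofReal (L x v)) f g t y ≤
      valueFunction (fun x v => ENNReal.ofReal (L x v)) f g t x +
        (T * (c₁ + K) + K) * ‖y - x‖ := by
  obtain ⟨r, r', h, hval⟩ := P.exists_value_eq ht x
  have h' := P.admissible_translate h (y - x)
  rw [add_sub_cancel] at h'
  refine (P.value_le ht h').trans ?_
  rw [hval, P.pathCost_eq ht.1 h, P.pathCost_eq ht.1 h']
  have hg := (abs_le.1 (P.initial_lip (r 0 + (y - x)) (r 0))).2
  have hint : ∀ {z : E} {r : ℝ → E},
      IsAdmissiblePath (fun x v => ENNReal.ofReal (L x v)) t z r r' →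
      IntegrableOn (fun τ => L (r τ) (r' τ) + f τ (r τ)) (Ioc 0 t) := fun k =>
    (P.integrable_running k Subset.rfl).add
      ((intervalIntegrable_iff_integrableOn_Ioc_of_le ht.1).1
        (P.intervalIntegrable_potential k.ac le_rfl ht.1 le_rfl))
  have hrun : ∫ τ in Ioc 0 t, (L (r τ + (y - x)) (r' τ) + f τ (r τ + (y - x))) ≤
      ∫ τ in Ioc 0 t, ((L (r τ) (r' τ) + f τ (r τ)) + (c₁ + K) * ‖y - x‖) := by
    refine integral_mono (hint h') ((hint h).add (integrable_const _)) fun τ => ?_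
    have h1 := (abs_le.1 (P.L_lip (r τ + (y - x)) (r τ) (r' τ))).2
    have h2 := (abs_le.1 (P.potential_lip τ (r τ + (y - x)) (r τ))).2
    rw [add_sub_cancel_left] at h1 h2
    beta_reduce
    linarith
  rw [integral_add (hint h) (integrable_const _), setIntegral_const, smul_eq_mul, Measure.real,
    Real.volume_Ioc, sub_zero, ENNReal.toReal_ofReal ht.1] at hrun
  rw [add_sub_cancel_left] at hg
  have h3 := mul_le_mul_of_nonneg_right ht.2
    (mul_nonneg (add_nonneg P.c₁_nonneg P.K_nonneg) (norm_nonneg (y - x)))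
  linarith

/-- The value function decreases at most linearly in time, and its increase controls the kinetic
energy of a minimizer. -/
theorem value_add_energy_le (P : IsRegularProblem L L₁ f f₁ g T l cf cg K m c₀ c₁)
    (h0 : 0 ≤ s) (hst : s ≤ t) (ht : t ≤ T)
    (h : IsAdmissiblePath (fun x v => ENNReal.ofReal (L x v)) t q r r')
    (hval : valueFunction (fun x v => ENNReal.ofReal (L x v)) f g t q =
      pathCost (fun x v => ENNReal.ofReal (L x v)) f g t r r') :
    valueFunction (fun x v => ENNReal.ofReal (L x v)) f g s q +
      c₀ / 2 * (∫ τ in s..t, ‖r' τ‖ ^ 2) ≤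
    valueFunction (fun x v => ENNReal.ofReal (L x v)) f g t q +
      (|m| + (T * (c₁ + K) + K) ^ 2 / (2 * c₀)) * (t - s) := by
  have h1 := P.value_ge_restrict h0 hst ht h hval
  have h2 := P.value_le_add_norm ⟨h0, hst.trans ht⟩ (r s) q
  have h3 := h.ac.norm_sub_sq_le h0 hst le_rfl
  rw [h.terminal] at h3
  have hM : 0 ≤ T * (c₁ + K) + K := by
    have := P.c₁_nonneg
    have := P.K_nonneg
    have := P.T_nonneg
    positivity
  have hA : c₀ * (∫ τ in s..t, ‖r' τ‖ ^ 2) ≤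
      (∫⁻ τ in Ioc s t, ENNReal.ofReal (L (r τ) (r' τ))).toReal := by
    rw [P.toReal_running h (Ioc_subset_Ioc_left h0), ← intervalIntegral.integral_of_le hst,
      ← intervalIntegral.integral_const_mul]
    exact intervalIntegral.integral_mono_on hst
      ((h.ac.intervalIntegrable_sq h0 hst le_rfl).const_mul _)
      ((intervalIntegrable_iff_integrableOn_Ioc_of_le hst).2
        (P.integrable_running h (Ioc_subset_Ioc_left h0))) fun τ _ => P.L_ge _ _
  have hF : (t - s) * m ≤ ∫ τ in s..t, f τ (r τ) := by
    have : ∫ _τ in s..t, m ≤ ∫ τ in s..t, f τ (r τ) :=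
      intervalIntegral.integral_mono_on hst (by simp)
        (P.intervalIntegrable_potential h.ac h0 hst le_rfl) fun τ _ => P.potential_ge τ _
    simpa using this
  have hX : 0 ≤ ∫ τ in s..t, ‖r' τ‖ ^ 2 :=
    intervalIntegral.integral_nonneg hst fun τ _ => by positivity
  set X := ∫ τ in s..t, ‖r' τ‖ ^ 2
  set M := T * (c₁ + K) + K
  have hc := P.c₀_pos
  have hts : 0 ≤ t - s := sub_nonneg.2 hst
  -- Young's inequality for M √((t - s)X): half of the coercive energy c₀X absorbs the spatial
  -- Lipschitz error, and the other half stays in the conclusion.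
  have hamgm : M * ‖q - r s‖ ≤ c₀ / 2 * X + M ^ 2 / (2 * c₀) * (t - s) := by
    refine abs_le_of_sq_le_sq' ?_ (by positivity) |>.2
    have e1 : (M * ‖q - r s‖) ^ 2 ≤ M ^ 2 * ((t - s) * X) := by
      rw [mul_pow]
      exact mul_le_mul_of_nonneg_left h3 (sq_nonneg M)
    have e2 : (c₀ / 2 * X + M ^ 2 / (2 * c₀) * (t - s)) ^ 2 =
        (c₀ / 2 * X - M ^ 2 / (2 * c₀) * (t - s)) ^ 2 + M ^ 2 * ((t - s) * X) := by
      field_simp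
      ring
    rw [e2]
    exact e1.trans (le_add_of_nonneg_left (sq_nonneg _))
  have hm : -(|m| * (t - s)) ≤ (t - s) * m := by
    nlinarith [neg_abs_le m]
  linarith

end IsRegularProblem

end Regularity

/-! ### Regularity in time and joint continuity of the gradient. -/

section HamiltonJacobi

variable {E : Type*} [NormedAddCommGroup E] [InnerProductSpace ℝ E] [CompleteSpace E]

namespace IsRegularProblem

variable {L : E → E → ℝ} {L₁ : E → E → E →L[ℝ] ℝ} {f : ℝ → E → ℝ} {f₁ : ℝ → E → E →L[ℝ] ℝ}
  {g : E → ℝ} {T l cf cg K m c₀ c₁ : ℝ} {s t : ℝ} {x y q : E} {r r' : ℝ → E}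

/-- The energy estimate bounds the decrease, and waiting at x bounds the increase. The constant is
affine in ‖x‖ because L(x,0) and f(τ,x) grow at most linearly. -/
theorem exists_value_time_lip (P : IsRegularProblem L L₁ f f₁ g T l cf cg K m c₀ c₁) :
    ∃ B, 0 ≤ B ∧ ∀ s t, 0 ≤ s → s ≤ t → t ≤ T → ∀ x,
      |valueFunction (fun x v => ENNReal.ofReal (L x v)) f g t x -
        valueFunction (fun x v => ENNReal.ofReal (L x v)) f g s x| ≤
          (B + (c₁ + K) * ‖x‖) * (t - s) := by
  obtain ⟨F, hF⟩ := isCompact_Icc.exists_bound_of_continuousOn (s := Icc 0 T)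
    (f := fun τ => f τ 0) (P.potential_cont.comp (Continuous.prodMk_left 0)).continuousOn
  have hF0 : 0 ≤ F := (norm_nonneg _).trans (hF 0 ⟨le_rfl, P.T_nonneg⟩)
  set C' := |m| + (T * (c₁ + K) + K) ^ 2 / (2 * c₀) with hC'
  have hc := P.c₀_pos
  have hc₁ := P.c₁_nonneg
  have hK := P.K_nonneg
  have hC0 : 0 ≤ C' := by positivity
  have hL0 := P.L_nonneg 0 0
  refine ⟨L 0 0 + F + C', by positivity, fun s t h0 hst ht x => ?_⟩
  have hts : 0 ≤ t - s := sub_nonneg.2 hst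
  have hpos : 0 ≤ (c₁ + K) * ‖x‖ := by positivity
  rw [abs_le]
  constructor
  · obtain ⟨r, r', h, hval⟩ := P.exists_value_eq ⟨h0.trans hst, ht⟩ x
    have h1 := P.value_add_energy_le h0 hst ht h hval
    have h2 : 0 ≤ ∫ τ in s..t, ‖r' τ‖ ^ 2 :=
      intervalIntegral.integral_nonneg hst fun τ _ => by positivity
    have h3 : 0 ≤ c₀ / 2 * ∫ τ in s..t, ‖r' τ‖ ^ 2 := by positivity
    have h4 : C' * (t - s) ≤ (L 0 0 + F + C' + (c₁ + K) * ‖x‖) * (t - s) := by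
      gcongr
      linarith
    rw [← hC'] at h1
    linarith
  · have hlin : ∫⁻ _τ in Ioc s t, ENNReal.ofReal (L x 0) = ENNReal.ofReal (L x 0 * (t - s)) := by
      rw [setLIntegral_const, Real.volume_Ioc, ← ENNReal.ofReal_mul (P.L_nonneg x 0)]
    have h1 := P.value_le_extend h0 hst ht (IsAC2.const t x) (by
      rw [hlin]; exact ofReal_ne_top)
    rw [hlin, ENNReal.toReal_ofReal (mul_nonneg (P.L_nonneg x 0) hts)] at h1
    have h2 : ∫ τ in s..t, f τ x ≤ ∫ _τ in s..t, (F + K * ‖x‖) := by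
      refine intervalIntegral.integral_mono_on hst
        ((P.potential_cont.comp (Continuous.prodMk_left x)).intervalIntegrable _ _) (by simp)
        fun τ hτ => ?_
      have e1 := (abs_le.1 (hF τ ⟨h0.trans hτ.1, hτ.2.trans ht⟩)).2
      have e2 := (abs_le.1 (P.potential_lip τ x 0)).2
      rw [sub_zero] at e2
      linarith
    rw [intervalIntegral.integral_const, smul_eq_mul] at h2
    have h3 := (abs_le.1 (P.L_lip x 0 0)).2
    rw [sub_zero] at h3
    have h4 : L x 0 * (t - s) ≤ (L 0 0 + c₁ * ‖x‖) * (t - s) := by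
      gcongr
      linarith
    have h5 : 0 ≤ C' * (t - s) := by positivity
    linarith

/-- As (t',q') → (t,q), the values converge locally uniformly. The gradient inequality, with a
constant independent of time, at (t',q') and differentiability at (t,q) then squeeze the gradients
together, without compactness. -/
theorem continuousOn_gradient (P : IsRegularProblem L L₁ f f₁ g T l cf cg K m c₀ c₁) :
    ContinuousOn (fun z : ℝ × E =>
      gradient (valueFunction (fun x v => ENNReal.ofReal (L x v)) f g z.1) z.2)
      (Icc 0 T ×ˢ univ) := by
  obtain ⟨B, hB0, hB⟩ := P.exists_value_time_lip
  set u := valueFunction (fun x v => ENNReal.ofReal (L x v)) f g with hu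
  set M := T * (c₁ + K) + K with hM
  set C := T * cf + cg with hC
  have hc₁ := P.c₁_nonneg
  have hK := P.K_nonneg
  have hT := P.T_nonneg
  have hcf := P.cf_nonneg
  have hcg := P.cg_nonneg
  have hM0 : 0 ≤ M := by positivity
  have hC0 : 0 ≤ C := by positivity
  have htime : ∀ t ∈ Icc 0 T, ∀ t' ∈ Icc 0 T, ∀ x,
      |u t' x - u t x| ≤ (B + (c₁ + K) * ‖x‖) * |t' - t| := by
    intro t ht t' ht' x
    rcases le_total t t' with h | h
    · rw [abs_of_nonneg (sub_nonneg.2 h)]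
      exact hB t t' ht.1 h ht'.2 x
    · rw [abs_sub_comm, abs_sub_comm t', abs_of_nonneg (sub_nonneg.2 h)]
      exact hB t' t ht'.1 h ht.2 x
  rintro ⟨t, q⟩ ⟨ht, -⟩
  have ht : t ∈ Icc 0 T := ht
  refine Metric.continuousWithinAt_iff'.2 fun ε hε => ?_
  have hd : ∀ᶠ h in 𝓝 (0 : E),
      |u t (q + h) - u t q - inner ℝ (gradient (u t) q) h| ≤ ε / 8 * ‖h‖ := by
    have h1 := hasFDerivAt_iff_isLittleO_nhds_zero.1
      (P.differentiable_value ht q).hasGradientAt.hasFDerivAt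
    rw [Asymptotics.isLittleO_iff] at h1
    exact h1 (by positivity)
  obtain ⟨ρ₀, hρ₀, hball⟩ := Metric.eventually_nhds_iff.1 hd
  -- The scale ρ is fixed first, so that the linearization error at (t,q) and the semiconvexity
  -- error are each at most ερ/8; only then is (t',q') brought close relative to ρ.
  obtain ⟨ρ, hρ, hρlt, hρ1, hρC⟩ : ∃ ρ > 0, ρ < ρ₀ ∧ ρ ≤ 1 ∧ C * ρ ≤ ε / 8 := by
    refine ⟨min (ρ₀ / 2) (min 1 (ε / (8 * (C + 1)))), by positivity, ?_, ?_, ?_⟩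
    · exact (min_le_left _ _).trans_lt (half_lt_self hρ₀)
    · exact (min_le_right _ _).trans (min_le_left _ _)
    · have h1 : min (ρ₀ / 2) (min 1 (ε / (8 * (C + 1)))) ≤ ε / (8 * (C + 1)) :=
        (min_le_right _ _).trans (min_le_right _ _)
      refine (mul_le_mul_of_nonneg_left h1 hC0).trans ?_
      rw [mul_div_assoc', div_le_div_iff₀ (by positivity) (by norm_num)]
      nlinarith
  have hclose : ∀ᶠ z : ℝ × E in 𝓝[Icc 0 T ×ˢ univ] (t, q),
      2 * (M * ‖z.2 - q‖) + 2 * ((B + (c₁ + K) * (‖q‖ + 1)) * |z.1 - t|) < ε / 8 * ρ := by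
    refine Filter.Eventually.filter_mono nhdsWithin_le_nhds ?_
    have h1 : Continuous fun z : ℝ × E =>
        2 * (M * ‖z.2 - q‖) + 2 * ((B + (c₁ + K) * (‖q‖ + 1)) * |z.1 - t|) := by fun_prop
    have h2 := h1.tendsto (t, q)
    simp only [sub_self, norm_zero, abs_zero, mul_zero, add_zero] at h2
    exact h2.eventually_lt_const (by positivity)
  filter_upwards [hclose, self_mem_nhdsWithin] with z hz hmem
  obtain ⟨t', q'⟩ := z
  have ht' : t' ∈ Icc 0 T := hmem.1
  rw [dist_eq_norm]
  simp only at hz ⊢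
  set D' := gradient (u t') q'
  set D := gradient (u t) q
  rcases eq_or_ne (D' - D) 0 with he | he
  · rw [he, norm_zero]
    exact hε
  have hepos : 0 < ‖D' - D‖ := norm_pos_iff.2 he
  -- The step of length ρ in the direction of D' - D turns the inner product into ρ‖D' - D‖.
  set h : E := (ρ / ‖D' - D‖) • (D' - D) with hh
  have hnorm : ‖h‖ = ρ := by
    rw [hh, norm_smul, Real.norm_of_nonneg (by positivity), div_mul_cancel₀ _ hepos.ne']
  have hinner : inner ℝ D' h - inner ℝ D h = ρ * ‖D' - D‖ := by
    rw [← inner_sub_left, hh, inner_smul_right, real_inner_self_eq_norm_sq]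
    field_simp
  have h1 := P.value_gradient_inequality ht' q' (q' + h)
  rw [add_sub_cancel_left, hnorm, ← hu, ← hC] at h1
  have h2 := (abs_le.1 (hball (by rw [dist_zero_right, hnorm]; exact hρlt))).2
  rw [hnorm] at h2
  have h3 := P.value_le_add_norm ht' (q + h) (q' + h)
  rw [add_sub_add_right_eq_sub, ← hu, ← hM] at h3
  have h4 := P.value_le_add_norm ht' q' q
  rw [norm_sub_rev, ← hu, ← hM] at h4
  have h5 := (abs_le.1 (htime t ht t' ht' (q + h))).2
  have h6 := (abs_le.1 (htime t ht t' ht' q)).1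
  have h7 : (B + (c₁ + K) * ‖q + h‖) * |t' - t| ≤
      (B + (c₁ + K) * (‖q‖ + 1)) * |t' - t| := by
    have := norm_add_le q h
    gcongr
    linarith
  have h8 : (B + (c₁ + K) * ‖q‖) * |t' - t| ≤ (B + (c₁ + K) * (‖q‖ + 1)) * |t' - t| := by
    gcongr
    linarith
  have h9 : C * ρ ^ 2 ≤ ε / 8 * ρ := by
    rw [sq, ← mul_assoc]
    exact mul_le_mul_of_nonneg_right hρC hρ.le
  have h10 : ρ * ‖D' - D‖ ≤ ρ * (ε / 2) := by
    rw [← hinner]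
    have h2' := abs_le.1 (hball (y := h) (by rw [dist_zero_right, hnorm]; exact hρlt)) |>.1
    rw [hnorm] at h2'
    linarith
  have := le_of_mul_le_mul_left h10 hρ
  linarith

end IsRegularProblem

end HamiltonJacobi

/-! ### The Hamilton–Jacobi equation for the value function. -/

section HamiltonJacobi

theorem exists_ball_of_eventually_nhdsWithin_prod {E : Type*} [NormedAddCommGroup E] {S : Set ℝ} {t₀ : ℝ} {q : E}
    {p : ℝ × E → Prop} (h : ∀ᶠ z in 𝓝[S ×ˢ univ] (t₀, q), p z) :
    ∃ ρ > 0, ∀ τ ∈ S, ∀ x, |τ - t₀| < ρ → ‖x - q‖ < ρ → p (τ, x) := by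
  obtain ⟨ρ, hρ, hsub⟩ := Metric.mem_nhdsWithin_iff.1 h
  refine ⟨ρ, hρ, fun τ hτ x h1 h2 => hsub ⟨?_, hτ, mem_univ _⟩⟩
  rw [Metric.mem_ball, Prod.dist_eq, Real.dist_eq, dist_eq_norm]
  exact max_lt h1 h2

variable {E : Type*} [NormedAddCommGroup E] [InnerProductSpace ℝ E] [CompleteSpace E]

namespace IsRegularProblem

variable {L : E → E → ℝ} {L₁ : E → E → E →L[ℝ] ℝ} {f : ℝ → E → ℝ} {f₁ : ℝ → E → E →L[ℝ] ℝ}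
  {g : E → ℝ} {H : E → E → ℝ} {T l cf cg K m c₀ c₁ : ℝ} {t₀ : ℝ} {q : E}

/-- Moving with a nearly optimal constant velocity bounds the increase of the value in time. -/
theorem value_sub_le (P : IsRegularProblem L L₁ f f₁ g T l cf cg K m c₀ c₁)
    (hLH : IsLegendreTransform (L q) (H q)) (ht₀ : t₀ ∈ Icc 0 T) {ε : ℝ} (hε : 0 < ε) :
    ∃ δ > 0, ∀ s t, 0 ≤ s → s ≤ t → t ≤ T → |s - t₀| < δ → |t - t₀| < δ →
      valueFunction (fun x v => ENNReal.ofReal (L x v)) f g t q -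
        valueFunction (fun x v => ENNReal.ofReal (L x v)) f g s q ≤
      (t - s) * (f t₀ q -
        H q (gradient (valueFunction (fun x v => ENNReal.ofReal (L x v)) f g t₀) q) + ε) := by
  have hgrad := P.continuousOn_gradient (t₀, q) ⟨ht₀, mem_univ _⟩
  set u := valueFunction (fun x v => ENNReal.ofReal (L x v)) f g with hu
  set C := T * cf + cg with hC
  -- A velocity within ε/5 of the supremum defining H(q,∇u(t₀,q)). The other four fifths go to L, f,
  -- the gradient and the quadratic remainder.
  obtain ⟨_, ⟨v, rfl⟩, hv⟩ := (lt_isLUB_iff (hLH (gradient (u t₀) q))).1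
    (sub_lt_self _ (show 0 < ε / 5 by positivity))
  simp only at hv
  have hLc : ∀ᶠ z : ℝ × E in 𝓝[Icc 0 T ×ˢ univ] (t₀, q), L z.2 v < L q v + ε / 5 := by
    refine Filter.Eventually.filter_mono nhdsWithin_le_nhds ?_
    have h1 : Continuous fun z : ℝ × E => L z.2 v :=
      P.L_cont.comp (continuous_snd.prodMk continuous_const)
    exact (h1.tendsto (t₀, q)).eventually_lt_const (lt_add_of_pos_right _ (by positivity))
  have hfc : ∀ᶠ z : ℝ × E in 𝓝[Icc 0 T ×ˢ univ] (t₀, q), f z.1 z.2 < f t₀ q + ε / 5 := by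
    refine Filter.Eventually.filter_mono nhdsWithin_le_nhds ?_
    exact (P.potential_cont.tendsto (t₀, q)).eventually_lt_const
      (lt_add_of_pos_right _ (by positivity))
  have hDc : ∀ᶠ z : ℝ × E in 𝓝[Icc 0 T ×ˢ univ] (t₀, q),
      inner ℝ (gradient (u t₀) q) v - ε / 5 < inner ℝ (gradient (u z.1) z.2) v :=
    (hgrad.inner tendsto_const_nhds).eventually_const_lt (sub_lt_self _ (by positivity))
  obtain ⟨ρ, hρ, hball⟩ := exists_ball_of_eventually_nhdsWithin_prod (hLc.and (hfc.and hDc))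
  have hδ : ∀ᶠ δ : ℝ in 𝓝[>] 0, δ < ρ ∧ 2 * δ * ‖v‖ < ρ ∧ C * (2 * δ) * ‖v‖ ^ 2 < ε / 5 := by
    refine Filter.Eventually.filter_mono nhdsWithin_le_nhds ?_
    have h1 : Tendsto (fun δ : ℝ => 2 * δ * ‖v‖) (𝓝 0) (𝓝 (2 * 0 * ‖v‖)) :=
      Continuous.tendsto (by fun_prop) 0
    have h2 : Tendsto (fun δ : ℝ => C * (2 * δ) * ‖v‖ ^ 2) (𝓝 0)
        (𝓝 (C * (2 * 0) * ‖v‖ ^ 2)) := Continuous.tendsto (by fun_prop) 0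
    simp only [mul_zero, zero_mul] at h1 h2
    exact (eventually_lt_nhds hρ).and ((h1.eventually_lt_const hρ).and
      (h2.eventually_lt_const (by positivity)))
  obtain ⟨δ, ⟨hδρ, hδv, hδC⟩, hδ0⟩ := (hδ.and self_mem_nhdsWithin).exists
  refine ⟨δ, hδ0, fun s t h0 hst ht hs1 ht1 => ?_⟩
  have hts : 0 ≤ t - s := sub_nonneg.2 hst
  have hts2 : t - s < 2 * δ := by linarith [(abs_lt.1 hs1).1, (abs_lt.1 ht1).2]
  have hcf := P.cf_nonneg
  have hcg := P.cg_nonneg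
  have hT := P.T_nonneg
  have hC0 : 0 ≤ C := by positivity
  have hnear : ∀ τ ∈ Icc s t, |τ - t₀| < ρ ∧ ‖q + (τ - t) • v - q‖ < ρ := by
    intro τ hτ
    constructor
    · refine lt_of_lt_of_le ?_ hδρ.le
      rw [abs_lt] at hs1 ht1 ⊢
      constructor <;> linarith [hτ.1, hτ.2]
    · rw [add_sub_cancel_left, norm_smul, Real.norm_eq_abs]
      refine lt_of_le_of_lt ?_ hδv
      gcongr
      rw [abs_le]
      constructor <;> linarith [hτ.1, hτ.2]
  have hmem : ∀ τ ∈ Icc s t, τ ∈ Icc 0 T := fun τ hτ => ⟨h0.trans hτ.1, hτ.2.trans ht⟩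
  have hval : ∀ τ ∈ Icc s t, L (q + (τ - t) • v) v < L q v + ε / 5 ∧
      f τ (q + (τ - t) • v) < f t₀ q + ε / 5 ∧
      inner ℝ (gradient (u t₀) q) v - ε / 5 <
        inner ℝ (gradient (u τ) (q + (τ - t) • v)) v := fun τ hτ =>
    hball τ (hmem τ hτ) _ (hnear τ hτ).1 (hnear τ hτ).2
  have hac : IsAC2 t (fun τ => q + (τ - t) • v) (fun _ => v) := IsAC2.affine t q v t
  have hLq : 0 ≤ L q v + ε / 5 := add_nonneg (P.L_nonneg q v) (by positivity)
  have hact : ∫⁻ τ in Ioc s t, ENNReal.ofReal (L (q + (τ - t) • v) v) ≤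
      ENNReal.ofReal ((L q v + ε / 5) * (t - s)) := by
    rw [ENNReal.ofReal_mul hLq, ← Real.volume_Ioc, ← setLIntegral_const]
    exact setLIntegral_mono measurable_const fun τ hτ =>
      ENNReal.ofReal_le_ofReal (hval τ ⟨hτ.1.le, hτ.2⟩).1.le
  have hact' := ENNReal.toReal_le_of_le_ofReal (mul_nonneg hLq hts) hact
  have hpot : ∫ τ in s..t, f τ (q + (τ - t) • v) ≤ ∫ _τ in s..t, (f t₀ q + ε / 5) :=
    intervalIntegral.integral_mono_on hst (P.intervalIntegrable_potential hac h0 hst le_rfl)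
      (by simp) fun τ hτ => (hval τ hτ).2.1.le
  rw [intervalIntegral.integral_const, smul_eq_mul] at hpot
  have hext := P.value_le_extend h0 hst ht hac (ne_top_of_le_ne_top ofReal_ne_top hact)
  rw [sub_self, zero_smul, add_zero, ← hu] at hext
  -- The inequality is based at the starting point of the line and evaluated at q: semiconvexity
  -- bounds the value at its base point from above, which is why continuity of the gradient is
  -- needed.
  have hg := P.value_gradient_inequality ⟨h0, hst.trans ht⟩ (q + (s - t) • v) q
  rw [show q - (q + (s - t) • v) = (t - s) • v by module, inner_smul_right, norm_smul,
    Real.norm_of_nonneg hts, ← hu, ← hC] at hg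
  have hgs := mul_le_mul_of_nonneg_left (hval s ⟨le_rfl, hst⟩).2.2.le hts
  have hq : C * ((t - s) * ‖v‖) ^ 2 ≤ (t - s) * (ε / 5) := by
    have e1 : C * (t - s) * ‖v‖ ^ 2 ≤ ε / 5 := by
      refine le_trans ?_ hδC.le
      gcongr
    have e2 := mul_le_mul_of_nonneg_left e1 hts
    linarith
  have hv' := mul_le_mul_of_nonneg_left hv.le hts
  linarith

/-- The Fenchel inequality along minimizers bounds the increase of the value from below. -/
theorem le_value_sub (P : IsRegularProblem L L₁ f f₁ g T l cf cg K m c₀ c₁)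
    (hH : Continuous (Function.uncurry H)) (hLH : ∀ x, IsLegendreTransform (L x) (H x))
    (ht₀ : t₀ ∈ Icc 0 T) {ε : ℝ} (hε : 0 < ε) :
    ∃ δ > 0, ∀ s t, 0 ≤ s → s ≤ t → t ≤ T → |s - t₀| < δ → |t - t₀| < δ →
      (t - s) * (f t₀ q -
        H q (gradient (valueFunction (fun x v => ENNReal.ofReal (L x v)) f g t₀) q) - ε) ≤
      valueFunction (fun x v => ENNReal.ofReal (L x v)) f g t q -
        valueFunction (fun x v => ENNReal.ofReal (L x v)) f g s q := by
  have hgrad := P.continuousOn_gradient (t₀, q) ⟨ht₀, mem_univ _⟩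
  obtain ⟨B, hB0, hB⟩ := P.exists_value_time_lip
  have henergy := @value_add_energy_le E _ _ L L₁ f f₁ g T l cf cg K m c₀ c₁
  set u := valueFunction (fun x v => ENNReal.ofReal (L x v)) f g with hu
  set C := T * cf + cg with hC
  set C' := |m| + (T * (c₁ + K) + K) ^ 2 / (2 * c₀) with hC'
  have hc := P.c₀_pos
  have hc₁ := P.c₁_nonneg
  have hK := P.K_nonneg
  have hcf := P.cf_nonneg
  have hcg := P.cg_nonneg
  have hT := P.T_nonneg
  have hC0 : 0 ≤ C := by positivity
  have hC'0 : 0 ≤ C' := by positivity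
  -- The time-Lipschitz bound inserted in the energy estimate gives ∫ ‖r'‖² ≤ N(t - s) on [s,t].
  -- Minimizers thus move by at most √N (t - s), and the quadratic remainder is O((t - s)²).
  set N := 2 / c₀ * (B + (c₁ + K) * ‖q‖ + C') with hN
  have hN0 : 0 ≤ N := by positivity
  have hHc : ∀ᶠ z : E × E in 𝓝 (q, gradient (u t₀) q),
      H z.1 z.2 < H q (gradient (u t₀) q) + ε / 3 :=
    (hH.tendsto (q, gradient (u t₀) q)).eventually_lt_const
      (lt_add_of_pos_right _ (by positivity))
  obtain ⟨ρ₁, hρ₁, hball₁⟩ := Metric.eventually_nhds_iff.1 hHc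
  have hfc : ∀ᶠ z : ℝ × E in 𝓝[Icc 0 T ×ˢ univ] (t₀, q), f t₀ q - ε / 3 < f z.1 z.2 := by
    refine Filter.Eventually.filter_mono nhdsWithin_le_nhds ?_
    exact (P.potential_cont.tendsto (t₀, q)).eventually_const_lt (sub_lt_self _ (by positivity))
  have hDc : ∀ᶠ z : ℝ × E in 𝓝[Icc 0 T ×ˢ univ] (t₀, q),
      dist (gradient (u z.1) z.2) (gradient (u t₀) q) < ρ₁ :=
    Metric.continuousWithinAt_iff'.1 hgrad ρ₁ hρ₁
  obtain ⟨ρ, hρ, hball⟩ := exists_ball_of_eventually_nhdsWithin_prod (hfc.and hDc)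
  have hδ : ∀ᶠ δ : ℝ in 𝓝[>] 0, δ < ρ ∧ √N * (2 * δ) < min ρ ρ₁ ∧
      C * N * (2 * δ) < ε / 3 := by
    refine Filter.Eventually.filter_mono nhdsWithin_le_nhds ?_
    have h1 : Tendsto (fun δ : ℝ => √N * (2 * δ)) (𝓝 0) (𝓝 (√N * (2 * 0))) :=
      Continuous.tendsto (by fun_prop) 0
    have h2 : Tendsto (fun δ : ℝ => C * N * (2 * δ)) (𝓝 0) (𝓝 (C * N * (2 * 0))) :=
      Continuous.tendsto (by fun_prop) 0
    simp only [mul_zero] at h1 h2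
    exact (eventually_lt_nhds hρ).and ((h1.eventually_lt_const (lt_min hρ hρ₁)).and
      (h2.eventually_lt_const (by positivity)))
  obtain ⟨δ, ⟨hδρ, hδN, hδC⟩, hδ0⟩ := (hδ.and self_mem_nhdsWithin).exists
  refine ⟨δ, hδ0, fun s t h0 hst ht hs1 ht1 => ?_⟩
  have hts : 0 ≤ t - s := sub_nonneg.2 hst
  have hts2 : t - s < 2 * δ := by linarith [(abs_lt.1 hs1).1, (abs_lt.1 ht1).2]
  obtain ⟨r, r', h, hval⟩ := P.exists_value_eq ⟨h0.trans hst, ht⟩ q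
  have hX : ∫ τ in s..t, ‖r' τ‖ ^ 2 ≤ N * (t - s) := by
    have e1 := henergy P h0 hst ht h hval
    have e2 := (abs_le.1 (hB s t h0 hst ht q)).2
    rw [hN, mul_assoc, div_mul_eq_mul_div, le_div_iff₀ hc]
    linarith
  have hdist : ∀ τ ∈ Icc s t, ‖r τ - q‖ ≤ √N * (t - s) := by
    intro τ hτ
    have e1 := h.ac.norm_sub_sq_le (h0.trans hτ.1) hτ.2 le_rfl
    have e2 := h.ac.integral_sq_mono h0 hτ.1 hτ.2 le_rfl
    rw [h.terminal, norm_sub_rev] at e1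
    refine abs_le_of_sq_le_sq' (le_trans e1 ?_) (by positivity) |>.2
    rw [mul_pow, Real.sq_sqrt hN0]
    calc (t - τ) * ∫ τ in τ..t, ‖r' τ‖ ^ 2 ≤ (t - s) * (N * (t - s)) := by
          refine mul_le_mul (by linarith [hτ.1]) (e2.trans hX) ?_ hts
          exact intervalIntegral.integral_nonneg hτ.2 fun _ _ => by positivity
      _ = _ := by ring
  have hdist' : ∀ τ ∈ Icc s t, ‖r τ - q‖ < min ρ ρ₁ := fun τ hτ =>
    (hdist τ hτ).trans_lt (lt_of_le_of_lt (by gcongr) hδN)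
  have htime : ∀ τ ∈ Icc s t, |τ - t₀| < ρ := by
    intro τ hτ
    refine lt_of_lt_of_le ?_ hδρ.le
    rw [abs_lt] at hs1 ht1 ⊢
    constructor <;> linarith [hτ.1, hτ.2]
  have hmem : ∀ τ ∈ Icc s t, τ ∈ Icc 0 T := fun τ hτ => ⟨h0.trans hτ.1, hτ.2.trans ht⟩
  -- A momentum constant along the path makes ∫⟨p, r'⟩ equal to ⟨p, q - r(s)⟩, which cancels the
  -- linear term of the gradient inequality based at (s,q).
  set p := gradient (u s) q with hp
  have hpdist : dist p (gradient (u t₀) q) < ρ₁ :=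
    (hball s (hmem s ⟨le_rfl, hst⟩) q (htime s ⟨le_rfl, hst⟩) (by simpa using hρ)).2
  have hfenchel : ∀ τ ∈ Icc s t,
      inner ℝ p (r' τ) - (H q (gradient (u t₀) q) + ε / 3) ≤ L (r τ) (r' τ) := by
    intro τ hτ
    have e1 : inner ℝ p (r' τ) - L (r τ) (r' τ) ≤ H (r τ) p :=
      (hLH (r τ) p).1 ⟨r' τ, rfl⟩
    have e2 : H (r τ) p < H q (gradient (u t₀) q) + ε / 3 := by
      refine hball₁ (y := (r τ, p)) ?_
      rw [Prod.dist_eq, dist_eq_norm]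
      exact max_lt ((hdist' τ hτ).trans_le (min_le_right _ _)) hpdist
    linarith
  have hr' := h.ac.intervalIntegrable h0 hst le_rfl
  have hact : inner ℝ p (q - r s) - (t - s) * (H q (gradient (u t₀) q) + ε / 3) ≤
      (∫⁻ τ in Ioc s t, ENNReal.ofReal (L (r τ) (r' τ))).toReal := by
    rw [P.toReal_running h (Ioc_subset_Ioc_left h0), ← intervalIntegral.integral_of_le hst]
    have hi : IntervalIntegrable (fun τ => inner ℝ p (r' τ)) volume s t :=
      ⟨(innerSL ℝ p).integrable_comp hr'.1, (innerSL ℝ p).integrable_comp hr'.2⟩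
    have e1 : ∫ τ in s..t, (inner ℝ p (r' τ) - (H q (gradient (u t₀) q) + ε / 3)) ≤
        ∫ τ in s..t, L (r τ) (r' τ) :=
      intervalIntegral.integral_mono_on hst (hi.sub (by simp))
        ((intervalIntegrable_iff_integrableOn_Ioc_of_le hst).2
          (P.integrable_running h (Ioc_subset_Ioc_left h0))) hfenchel
    have e2 : ∫ τ in s..t, inner ℝ p (r' τ) = inner ℝ p (q - r s) := by
      rw [← h.terminal, h.ac.sub_eq h0 hst le_rfl]
      exact (innerSL ℝ p).intervalIntegral_comp_comm hr'
    rwa [intervalIntegral.integral_sub hi (by simp), intervalIntegral.integral_const,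
      smul_eq_mul, e2] at e1
  have hpot : ∫ _τ in s..t, (f t₀ q - ε / 3) ≤ ∫ τ in s..t, f τ (r τ) :=
    intervalIntegral.integral_mono_on hst (by simp)
      (P.intervalIntegrable_potential h.ac h0 hst le_rfl) fun τ hτ =>
        (hball τ (hmem τ hτ) _ (htime τ hτ) ((hdist' τ hτ).trans_le (min_le_left _ _))).1.le
  rw [intervalIntegral.integral_const, smul_eq_mul] at hpot
  have hres := P.value_ge_restrict h0 hst ht h hval
  have hg := P.value_gradient_inequality ⟨h0, hst.trans ht⟩ q (r s)
  rw [← hu, ← hp, ← hC, ← neg_sub q (r s), inner_neg_right, neg_sub] at hg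
  rw [← hu] at hres
  have hq : C * ‖r s - q‖ ^ 2 ≤ (t - s) * (ε / 3) := by
    have e1 : ‖r s - q‖ ^ 2 ≤ (√N * (t - s)) ^ 2 := by
      have := hdist s ⟨le_rfl, hst⟩
      gcongr
    rw [mul_pow, Real.sq_sqrt hN0] at e1
    have e2 : C * N * (t - s) ≤ ε / 3 := le_trans (by gcongr) hδC.le
    have e3 := mul_le_mul_of_nonneg_left e1 hC0
    have e4 := mul_le_mul_of_nonneg_left e2 hts
    linarith
  linarith

/-- The two bounds hold for all s ≤ t near t₀, so taking t₀ as either endpoint controls the right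
and the left difference quotients. -/
theorem hasDerivWithinAt_value (P : IsRegularProblem L L₁ f f₁ g T l cf cg K m c₀ c₁)
    (hH : Continuous (Function.uncurry H)) (hLH : ∀ x, IsLegendreTransform (L x) (H x))
    (ht₀ : t₀ ∈ Icc 0 T) (q : E) :
    HasDerivWithinAt (fun t => valueFunction (fun x v => ENNReal.ofReal (L x v)) f g t q)
      (f t₀ q - H q (gradient (valueFunction (fun x v => ENNReal.ofReal (L x v)) f g t₀) q))
      (Icc 0 T) t₀ := by
  rw [hasDerivWithinAt_iff_isLittleO, Asymptotics.isLittleO_iff]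
  intro ε hε
  obtain ⟨δ₁, hδ₁, h₁⟩ := P.value_sub_le (hLH q) ht₀ hε
  obtain ⟨δ₂, hδ₂, h₂⟩ := P.le_value_sub (q := q) hH hLH ht₀ hε
  have hnear : ∀ᶠ t in 𝓝[Icc 0 T] t₀, |t - t₀| < min δ₁ δ₂ := by
    refine Filter.Eventually.filter_mono nhdsWithin_le_nhds ?_
    exact Metric.eventually_nhds_iff.2 ⟨min δ₁ δ₂, lt_min hδ₁ hδ₂, fun t ht => ht⟩
  filter_upwards [hnear, self_mem_nhdsWithin] with t hlt ht
  have hlt₁ := hlt.trans_le (min_le_left _ _)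
  have hlt₂ := hlt.trans_le (min_le_right _ _)
  rw [smul_eq_mul, Real.norm_eq_abs, Real.norm_eq_abs]
  rcases le_total t₀ t with hle | hle
  · have e1 := h₁ t₀ t ht₀.1 hle ht.2 (by simpa using hδ₁) hlt₁
    have e2 := h₂ t₀ t ht₀.1 hle ht.2 (by simpa using hδ₂) hlt₂
    rw [abs_of_nonneg (sub_nonneg.2 hle), abs_le]
    constructor <;> linarith
  · have e1 := h₁ t t₀ ht.1 hle ht₀.2 hlt₁ (by simpa using hδ₁)
    have e2 := h₂ t t₀ ht.1 hle ht₀.2 hlt₂ (by simpa using hδ₂)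
    rw [abs_of_nonpos (sub_nonpos.2 hle), abs_le]
    constructor <;> linarith

end IsRegularProblem

end HamiltonJacobi

/-! ### The Lagrangian and the interaction functions -/

section Semiconvexity

/-- Along the segment, adding (M/2)‖y - x‖²e² makes the derivative monotone. -/
theorem semiconvex_of_lipschitz_fderiv {E : Type*} [NormedAddCommGroup E] [NormedSpace ℝ E]
    {W : E → ℝ} {M : ℝ} (hW : Differentiable ℝ W)
    (hM : ∀ x y, ‖fderiv ℝ W x - fderiv ℝ W y‖ ≤ M * ‖x - y‖) (x y : E) {a b : ℝ}
    (ha : 0 ≤ a) (hb : 0 ≤ b) (hab : a + b = 1) :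
    W (a • x + b • y) ≤ a * W x + b * W y + a * b * (M / 2) * ‖x - y‖ ^ 2 := by
  set φ : ℝ → ℝ := fun e => W (x + e • (y - x)) + M / 2 * ‖y - x‖ ^ 2 * e ^ 2 with hφ
  have hd : ∀ e, HasDerivAt φ (fderiv ℝ W (x + e • (y - x)) (y - x) + M * ‖y - x‖ ^ 2 * e) e := by
    intro e
    have h1 : HasDerivAt (fun e : ℝ => x + e • (y - x)) (y - x) e := by
      simpa using ((hasDerivAt_id e).smul_const (y - x)).const_add x
    have h2 := (hW (x + e • (y - x))).hasFDerivAt.comp_hasDerivAt e h1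
    have h3 := (hasDerivAt_pow 2 e).const_mul (M / 2 * ‖y - x‖ ^ 2)
    refine (h2.add h3).congr_deriv ?_
    norm_num
    ring
  have hmono : Monotone (deriv φ) := by
    intro e₁ e₂ he
    rw [(hd e₁).deriv, (hd e₂).deriv]
    have h1 : ‖(fderiv ℝ W (x + e₁ • (y - x)) - fderiv ℝ W (x + e₂ • (y - x))) (y - x)‖ ≤
        M * ((e₂ - e₁) * ‖y - x‖) * ‖y - x‖ := by
      refine (ContinuousLinearMap.le_opNorm _ _).trans
        (mul_le_mul_of_nonneg_right ((hM _ _).trans_eq ?_) (norm_nonneg _))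
      rw [add_sub_add_left_eq_sub, ← sub_smul, norm_smul, Real.norm_eq_abs, abs_sub_comm,
        abs_of_nonneg (sub_nonneg.2 he)]
    rw [sub_apply, Real.norm_eq_abs] at h1
    have := (abs_le.1 h1).2
    linarith
  have hconv : ConvexOn ℝ univ φ :=
    (hmono.monotoneOn _).convexOn_of_deriv convex_univ
      (fun e _ => (hd e).continuousAt.continuousWithinAt)
      (fun e _ => (hd e).differentiableAt.differentiableWithinAt)
  have h := hconv.2 (mem_univ 0) (mem_univ 1) ha hb hab
  simp only [hφ, smul_eq_mul, mul_zero, mul_one, zero_add, zero_smul, add_zero, one_smul,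
    add_sub_cancel] at h
  rw [show x + b • (y - x) = a • x + b • y by
    rw [eq_sub_of_add_eq hab]; module, norm_sub_rev y x] at h
  obtain rfl : a = 1 - b := eq_sub_of_add_eq hab
  norm_num at h
  linarith

end Semiconvexity

section Assumptions

variable {d : ℕ}

namespace IsInteractionFunction

variable {W : EuclideanSpace ℝ (Fin d) → ℝ} {c : ℝ}

theorem differentiable (hW : IsInteractionFunction W c) : Differentiable ℝ W :=
  hW.contDiff.differentiable (by norm_num)

theorem differentiable_fderiv (hW : IsInteractionFunction W c) : Differentiable ℝ (fderiv ℝ W) :=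
  (hW.contDiff.fderiv_right (m := 2) (by norm_num)).differentiable (by norm_num)

theorem exists_norm_fderiv_le (hW : IsInteractionFunction W c) :
    ∃ K, 0 ≤ K ∧ ∀ x, ‖fderiv ℝ W x‖ ≤ K := by
  obtain ⟨K, hK⟩ := hW.bdd_deriv 1 (by simp)
  refine ⟨K, (norm_nonneg _).trans (hK 0), fun x => ?_⟩
  rw [← norm_iteratedFDeriv_one]
  exact hK x

theorem iSup_nonneg (W : EuclideanSpace ℝ (Fin d) → ℝ) :
    0 ≤ ⨆ x, ‖iteratedFDeriv ℝ 2 W x‖ :=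
  Real.iSup_nonneg fun _ => norm_nonneg _

theorem norm_fderiv_sub_le (hW : IsInteractionFunction W c) (x y : EuclideanSpace ℝ (Fin d)) :
    ‖fderiv ℝ W x - fderiv ℝ W y‖ ≤ (⨆ z, ‖iteratedFDeriv ℝ 2 W z‖) * ‖x - y‖ := by
  refine Convex.norm_image_sub_le_of_norm_fderiv_le (𝕜 := ℝ)
    (fun z _ => hW.differentiable_fderiv z) (fun z _ => ?_) convex_univ (mem_univ y) (mem_univ x)
  rw [← norm_iteratedFDeriv_one, norm_iteratedFDeriv_fderiv]
  -- Boundedness matters: a real supremum over an unbounded family would be 0.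
  obtain ⟨C, hC⟩ := hW.bdd_deriv 2 (by simp)
  exact le_ciSup (f := fun z => ‖iteratedFDeriv ℝ 2 W z‖)
    ⟨C, by rintro _ ⟨z, rfl⟩; exact hC z⟩ z

theorem abs_sub_le {K : ℝ} (hW : IsInteractionFunction W c) (hK : ∀ x, ‖fderiv ℝ W x‖ ≤ K)
    (x y : EuclideanSpace ℝ (Fin d)) : |W x - W y| ≤ K * ‖x - y‖ :=
  Convex.norm_image_sub_le_of_norm_fderiv_le (𝕜 := ℝ)
    (fun z _ => hW.differentiable z) (fun z _ => hK z) convex_univ (mem_univ y) (mem_univ x)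

theorem semiconvex (hW : IsInteractionFunction W c) (x y : EuclideanSpace ℝ (Fin d)) {a b : ℝ}
    (ha : 0 ≤ a) (hb : 0 ≤ b) (hab : a + b = 1) :
    W (a • x + b • y) ≤ a * W x + b * W y +
      a * b * ((⨆ z, ‖iteratedFDeriv ℝ 2 W z‖) / 2) * ‖x - y‖ ^ 2 :=
  semiconvex_of_lipschitz_fderiv hW.differentiable hW.norm_fderiv_sub_le x y ha hb hab

end IsInteractionFunction

namespace IsAdmissibleLagrangian

variable {L : EuclideanSpace ℝ (Fin d) → EuclideanSpace ℝ (Fin d) → ℝ} {c₀ c₁ l₀ : ℝ}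

theorem continuous (hL : IsAdmissibleLagrangian L c₀ c₁ l₀) : Continuous (Function.uncurry L) :=
  hL.contDiff.continuous

theorem hasFDerivAt (hL : IsAdmissibleLagrangian L c₀ c₁ l₀) (x v : EuclideanSpace ℝ (Fin d)) :
    HasFDerivAt (fun z => L z v) (fderiv ℝ (fun z => L z v) x) x := by
  have h : ContDiff ℝ 3 fun z => L z v := hL.contDiff.comp (contDiff_prodMk_left v)
  exact (h.differentiable (by norm_num) x).hasFDerivAt

theorem continuous_fderiv (hL : IsAdmissibleLagrangian L c₀ c₁ l₀) :
    Continuous (Function.uncurry fun x v => fderiv ℝ (fun z => L z v) x) := by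
  have h : ContDiff ℝ 3 (Function.uncurry fun (p : EuclideanSpace ℝ (Fin d) ×
      EuclideanSpace ℝ (Fin d)) z => L z p.2) :=
    hL.contDiff.comp (contDiff_snd.prodMk (contDiff_snd.comp contDiff_fst))
  exact (h.fderiv (n := 2) contDiff_fst (by norm_num)).continuous

theorem norm_fderiv_le (hL : IsAdmissibleLagrangian L c₀ c₁ l₀)
    (x v : EuclideanSpace ℝ (Fin d)) : ‖fderiv ℝ (fun z => L z v) x‖ ≤ c₁ := by
  simpa [gradient] using hL.gradient_bound x v

theorem strongly_convex (hL : IsAdmissibleLagrangian L c₀ c₁ l₀)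
    (x₀ x₁ v₀ v₁ : EuclideanSpace ℝ (Fin d)) {a b : ℝ} (ha : 0 ≤ a) (hb : 0 ≤ b)
    (hab : a + b = 1) :
    L (a • x₀ + b • x₁) (a • v₀ + b • v₁) + a * b * (l₀ / 2) * ‖v₀ - v₁‖ ^ 2 ≤
      a * L x₀ v₀ + b * L x₁ v₁ := by
  set ψ : ℝ → ℝ := fun e => L ((1 - e) • x₀ + e • x₁) ((1 - e) • v₀ + e • v₁) with hψ
  have hsmooth : ContDiff ℝ 3 ψ := by
    refine hL.contDiff.comp (f := fun e : ℝ =>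
      ((1 - e) • x₀ + e • x₁, (1 - e) • v₀ + e • v₁)) ?_
    fun_prop
  -- Chosen so that 2k is the assumed lower bound of ψ''; then ψ(e) - k e² is convex on [0,1].
  set k := l₀ / 2 * ‖v₁ - v₀‖ ^ 2 with hk
  have hd1 : ∀ e, HasDerivAt (fun e => ψ e - k * e ^ 2) (deriv ψ e - 2 * k * e) e := by
    intro e
    have h1 := (hsmooth.differentiable (by norm_num) e).hasDerivAt
    refine (h1.sub ((hasDerivAt_pow 2 e).const_mul k)).congr_deriv ?_
    norm_num
    ring
  have hderiv : deriv (fun e => ψ e - k * e ^ 2) = fun e => deriv ψ e - 2 * k * e :=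
    funext fun e => (hd1 e).deriv
  have hdiff : Differentiable ℝ (deriv ψ) :=
    ((contDiff_succ_iff_deriv (n := 2)).1
      (hsmooth.of_le (by norm_num))).2.2.differentiable (by norm_num)
  have hd2 : ∀ e, HasDerivAt (fun e => deriv ψ e - 2 * k * e) (deriv (deriv ψ) e - 2 * k) e := by
    intro e
    exact ((hdiff e).hasDerivAt.sub ((hasDerivAt_id e).const_mul (2 * k))).congr_deriv
      (by rw [mul_one])
  have hconv : ConvexOn ℝ (Icc 0 1) fun e => ψ e - k * e ^ 2 := by
    refine convexOn_of_deriv2_nonneg (convex_Icc 0 1)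
      (fun e _ => (hd1 e).continuousAt.continuousWithinAt)
      (fun e _ => (hd1 e).differentiableAt.differentiableWithinAt) ?_ fun e he => ?_
    · rw [hderiv]
      exact fun e _ => (hd2 e).differentiableAt.differentiableWithinAt
    · rw [Function.iterate_succ, Function.iterate_one, Function.comp_apply, hderiv,
        (hd2 e).deriv]
      have h := hL.convexity x₀ x₁ v₀ v₁ e (interior_subset he)
      rw [iteratedDeriv_eq_iterate, Function.iterate_succ, Function.iterate_one,
        Function.comp_apply] at h
      rw [hk]
      linarith
  have h := hconv.2 (show (0 : ℝ) ∈ Icc 0 1 by simp) (show (1 : ℝ) ∈ Icc 0 1 by simp) ha hb hab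
  obtain rfl : a = 1 - b := eq_sub_of_add_eq hab
  simp only [hψ, smul_eq_mul, mul_zero, mul_one, zero_add, sub_zero, zero_smul, add_zero,
    one_smul, sub_self] at h
  rw [norm_sub_rev]
  norm_num at h
  rw [hk] at h
  linarith

end IsAdmissibleLagrangian

end Assumptions

/-! ### Interaction energies on the label space -/

section LabelSpace

instance isProbabilityMeasure_labelMeasure : IsProbabilityMeasure labelMeasure :=
  ⟨by simp [labelMeasure]⟩

variable {d : ℕ} {F : Type*} [NormedAddCommGroup F]

theorem LabelSpace.integrable_norm (X : LabelSpace d) :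
    Integrable (fun ω => ‖X ω‖) labelMeasure :=
  ((Lp.memLp X).integrable (by norm_num)).norm

theorem LabelSpace.integrable_norm_sq (X : LabelSpace d) :
    Integrable (fun ω => ‖X ω‖ ^ 2) labelMeasure :=
  (Lp.memLp X).integrable_norm_pow (p := 2) two_ne_zero

theorem LabelSpace.integral_norm_le (X : LabelSpace d) :
    ∫ ω, ‖X ω‖ ∂labelMeasure ≤ ‖X‖ := by
  rw [integral_norm_eq_lintegral_enorm (Lp.aestronglyMeasurable X), ← eLpNorm_one_eq_lintegral_enorm,
    Lp.norm_def]
  exact ENNReal.toReal_mono (Lp.memLp X).eLpNorm_ne_top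
    (eLpNorm_le_eLpNorm_of_exponent_le (by norm_num) (Lp.aestronglyMeasurable X))

theorem LabelSpace.coeFn_combination (a b : ℝ) (X Y : LabelSpace d) :
    ∀ᵐ ω ∂labelMeasure, (a • X + b • Y) ω = a • X ω + b • Y ω := by
  filter_upwards [Lp.coeFn_add (a • X) (b • Y), Lp.coeFn_smul a X, Lp.coeFn_smul b Y]
    with ω h1 h2 h3
  rw [h1, Pi.add_apply, h2, h3, Pi.smul_apply, Pi.smul_apply]

variable {W : EuclideanSpace ℝ (Fin d) → F} {K : ℝ}

theorem continuous_of_lip (hW : ∀ x y, ‖W x - W y‖ ≤ K * ‖x - y‖) : Continuous W :=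
  (LipschitzWith.of_dist_le' (K := K) fun x y => by
    simpa only [dist_eq_norm] using hW x y).continuous

theorem integrable_comp_of_lip (hW : ∀ x y, ‖W x - W y‖ ≤ K * ‖x - y‖) (X : LabelSpace d) :
    Integrable (fun ω => W (X ω)) labelMeasure := by
  refine Integrable.mono' ((X.integrable_norm.const_mul K).add (integrable_const ‖W 0‖))
    ((continuous_of_lip hW).comp_aestronglyMeasurable (Lp.aestronglyMeasurable X))
    (Eventually.of_forall fun ω => ?_)
  have h1 := hW (X ω) 0
  rw [sub_zero] at h1
  have h2 := norm_le_norm_sub_add (W (X ω)) (W 0)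
  simp only [Pi.add_apply]
  linarith

theorem integrable_interaction (hW : ∀ x y, ‖W x - W y‖ ≤ K * ‖x - y‖)
    (q : EuclideanSpace ℝ (Fin d)) (X : LabelSpace d) :
    Integrable (fun ω => W (q - X ω)) labelMeasure := by
  refine integrable_comp_of_lip (W := fun x => W (q - x)) (K := K) (fun x y => ?_) X
  refine (hW _ _).trans_eq ?_
  rw [show q - x - (q - y) = y - x by abel, norm_sub_rev]

theorem integral_norm_sub_le (X Y : LabelSpace d) :
    ∫ ω, ‖X ω - Y ω‖ ∂labelMeasure ≤ ‖X - Y‖ := by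
  refine le_trans (le_of_eq (integral_congr_ae ?_)) (X - Y).integral_norm_le
  filter_upwards [Lp.coeFn_sub X Y] with ω h
  rw [h, Pi.sub_apply]

theorem integrable_norm_sub (X Y : LabelSpace d) :
    Integrable (fun ω => ‖X ω - Y ω‖) labelMeasure :=
  (((Lp.memLp X).sub (Lp.memLp Y)).integrable (by norm_num)).norm

theorem norm_integral_interaction_sub_le [NormedSpace ℝ F] (hK : 0 ≤ K)
    (hW : ∀ x y, ‖W x - W y‖ ≤ K * ‖x - y‖) (q q' : EuclideanSpace ℝ (Fin d))
    (X X' : LabelSpace d) :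
    ‖(∫ ω, W (q - X ω) ∂labelMeasure) - ∫ ω, W (q' - X' ω) ∂labelMeasure‖ ≤
      K * (‖q - q'‖ + ‖X - X'‖) := by
  rw [← integral_sub (integrable_interaction hW q X) (integrable_interaction hW q' X')]
  refine (norm_integral_le_of_norm_le (((integrable_const ‖q - q'‖).add
    (integrable_norm_sub X X')).const_mul K) (Eventually.of_forall fun ω => ?_)).trans ?_
  · refine (hW _ _).trans (mul_le_mul_of_nonneg_left ?_ hK)
    rw [sub_sub_sub_comm]
    exact norm_sub_le _ _
  · simp only [Pi.add_apply]
    rw [integral_const_mul, integral_add (integrable_const _) (integrable_norm_sub X X'),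
      integral_const, probReal_univ, one_smul]
    gcongr
    exact integral_norm_sub_le X X'

/-- The codomain is general because this serves both for W and for its derivative. -/
theorem continuous_integral_interaction [NormedSpace ℝ F] (hK : 0 ≤ K)
    (hW : ∀ x y, ‖W x - W y‖ ≤ K * ‖x - y‖) :
    Continuous fun z : EuclideanSpace ℝ (Fin d) × LabelSpace d =>
      ∫ ω, W (z.1 - z.2 ω) ∂labelMeasure := by
  refine continuous_iff_continuousAt.2 fun z => tendsto_iff_norm_sub_tendsto_zero.2 ?_
  refine squeeze_zero (fun _ => norm_nonneg _)
    (fun z' => norm_integral_interaction_sub_le hK hW z'.1 z.1 z'.2 z.2) ?_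
  have : Continuous fun z' : EuclideanSpace ℝ (Fin d) × LabelSpace d =>
    K * (‖z'.1 - z.1‖ + ‖z'.2 - z.2‖) := by fun_prop
  simpa using this.tendsto z

end LabelSpace

section Interaction

variable {d : ℕ} {W : EuclideanSpace ℝ (Fin d) → ℝ} {c K : ℝ}

namespace IsInteractionFunction

theorem hasFDerivAt_interaction (hW : IsInteractionFunction W c) (q : EuclideanSpace ℝ (Fin d))
    (X : LabelSpace d) :
    HasFDerivAt (fun q => interaction W q X) (∫ ω, fderiv ℝ W (q - X ω) ∂labelMeasure) q := by
  obtain ⟨K, -, hK⟩ := hW.exists_norm_fderiv_le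
  refine hasFDerivAt_integral_of_dominated_of_fderiv_le (s := univ) (bound := fun _ => K)
    (F' := fun q ω => fderiv ℝ W (q - X ω)) univ_mem
    (Eventually.of_forall fun q => (integrable_interaction (hW.abs_sub_le hK) q X).1)
    (integrable_interaction (hW.abs_sub_le hK) q X)
    (integrable_interaction hW.norm_fderiv_sub_le q X).1
    (Eventually.of_forall fun ω q _ => hK _) (integrable_const _)
    (Eventually.of_forall fun ω q _ => ?_)
  exact (hasFDerivAt_comp_sub (X ω)).2 (hW.differentiable _).hasFDerivAt

theorem norm_fderiv_interaction_le (hK : ∀ x, ‖fderiv ℝ W x‖ ≤ K)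
    (q : EuclideanSpace ℝ (Fin d)) (X : LabelSpace d) :
    ‖∫ ω, fderiv ℝ W (q - X ω) ∂labelMeasure‖ ≤ K := by
  simpa using norm_integral_le_of_norm_le (μ := labelMeasure) (integrable_const K)
    (Eventually.of_forall fun ω => hK (q - X ω))

theorem abs_interaction_sub_le (hW : IsInteractionFunction W c) (hK0 : 0 ≤ K)
    (hK : ∀ x, ‖fderiv ℝ W x‖ ≤ K) (q q' : EuclideanSpace ℝ (Fin d)) (X X' : LabelSpace d) :
    |interaction W q X - interaction W q' X'| ≤ K * (‖q - q'‖ + ‖X - X'‖) :=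
  norm_integral_interaction_sub_le (W := W) hK0 (hW.abs_sub_le hK) q q' X X'

theorem le_interaction (hW : IsInteractionFunction W c) {m : ℝ} (hm : ∀ x, m ≤ W x)
    (q : EuclideanSpace ℝ (Fin d)) (X : LabelSpace d) : m ≤ interaction W q X := by
  obtain ⟨K, -, hK⟩ := hW.exists_norm_fderiv_le
  have := integral_mono (integrable_const m) (integrable_interaction (hW.abs_sub_le hK) q X)
    fun ω => hm _
  rwa [integral_const, probReal_univ, one_smul] at this

theorem interaction_semiconvex (hW : IsInteractionFunction W c)
    (x y : EuclideanSpace ℝ (Fin d)) (X : LabelSpace d) {a b : ℝ}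
    (ha : 0 ≤ a) (hb : 0 ≤ b) (hab : a + b = 1) :
    interaction W (a • x + b • y) X ≤ a * interaction W x X + b * interaction W y X +
      a * b * ((⨆ z, ‖iteratedFDeriv ℝ 2 W z‖) / 2) * ‖x - y‖ ^ 2 := by
  obtain ⟨K, -, hK⟩ := hW.exists_norm_fderiv_le
  have hi := fun q => integrable_interaction (W := W) (hW.abs_sub_le hK) q X
  have hi₂ : Integrable (fun ω => a * W (x - X ω) + b * W (y - X ω)) labelMeasure :=
    ((hi x).const_mul a).add ((hi y).const_mul b)
  have h := integral_mono (hi (a • x + b • y)) (hi₂.add (integrable_const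
      (a * b * ((⨆ z, ‖iteratedFDeriv ℝ 2 W z‖) / 2) * ‖x - y‖ ^ 2))) fun ω => by
    have h := hW.semiconvex (x - X ω) (y - X ω) ha hb hab
    rw [sub_sub_sub_cancel_right, show a • (x - X ω) + b • (y - X ω) = a • x + b • y - X ω by
      rw [eq_sub_of_add_eq hab]; module] at h
    exact h
  simp only [Pi.add_apply] at h
  rwa [integral_add hi₂ (integrable_const _),
    integral_add ((hi x).const_mul a) ((hi y).const_mul b), integral_const_mul,
    integral_const_mul, integral_const, probReal_univ, one_smul] at h

theorem totalInteraction_eq (W : EuclideanSpace ℝ (Fin d) → ℝ) (X : LabelSpace d) :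
    totalInteraction W X = 1 / 2 * ∫ ω, interaction W (X ω) X ∂labelMeasure := rfl

theorem integrable_interaction_self (hW : IsInteractionFunction W c) (X Y : LabelSpace d) :
    Integrable (fun ω => interaction W (Y ω) X) labelMeasure := by
  obtain ⟨K, hK0, hK⟩ := hW.exists_norm_fderiv_le
  refine integrable_comp_of_lip (W := fun q => interaction W q X) (K := K) (fun x y => ?_) Y
  simpa using hW.abs_interaction_sub_le hK0 hK x y X X

theorem abs_totalInteraction_sub_le (hW : IsInteractionFunction W c) (hK0 : 0 ≤ K)
    (hK : ∀ x, ‖fderiv ℝ W x‖ ≤ K) (X Y : LabelSpace d) :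
    |totalInteraction W X - totalInteraction W Y| ≤ K * ‖X - Y‖ := by
  rw [totalInteraction_eq, totalInteraction_eq, ← mul_sub,
    ← integral_sub (hW.integrable_interaction_self X X) (hW.integrable_interaction_self Y Y),
    abs_mul, abs_of_pos (by norm_num)]
  have h : ‖∫ ω, (interaction W (X ω) X - interaction W (Y ω) Y) ∂labelMeasure‖ ≤
      ∫ ω, K * (‖X ω - Y ω‖ + ‖X - Y‖) ∂labelMeasure :=
    norm_integral_le_of_norm_le (((integrable_norm_sub X Y).add (integrable_const _)).const_mul K)
      (Eventually.of_forall fun ω => hW.abs_interaction_sub_le hK0 hK _ _ _ _)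
  rw [integral_const_mul, integral_add (integrable_norm_sub X Y) (integrable_const _),
    integral_const, probReal_univ, one_smul, Real.norm_eq_abs] at h
  have h1 := mul_le_mul_of_nonneg_left (integral_norm_sub_le X Y) hK0
  linarith

theorem le_totalInteraction (hW : IsInteractionFunction W c) {m : ℝ} (hm : ∀ x, m ≤ W x)
    (X : LabelSpace d) : m / 2 ≤ totalInteraction W X := by
  have := integral_mono (integrable_const m) (hW.integrable_interaction_self X X)
    fun ω => hW.le_interaction hm _ _
  rw [integral_const, probReal_univ, one_smul] at this
  rw [totalInteraction_eq]
  linarith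

/-- The squared difference of X(ω) - X(ω') and Y(ω) - Y(ω') is at most 2(D(ω) + D(ω')), which
integrates to 4‖X - Y‖². With the prefactor ½ and modulus M of W this gives modulus 2M. -/
theorem totalInteraction_semiconvex (hW : IsInteractionFunction W c) (X Y : LabelSpace d)
    {a b : ℝ} (ha : 0 ≤ a) (hb : 0 ≤ b) (hab : a + b = 1) :
    totalInteraction W (a • X + b • Y) ≤ a * totalInteraction W X + b * totalInteraction W Y +
      a * b * (2 * (⨆ z, ‖iteratedFDeriv ℝ 2 W z‖) / 2) * ‖X - Y‖ ^ 2 := by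
  obtain ⟨K, hK0, hK⟩ := hW.exists_norm_fderiv_le
  have hlip := hW.abs_sub_le hK
  have hM0 := iSup_nonneg W
  set M := ⨆ z, ‖iteratedFDeriv ℝ 2 W z‖
  set D : ℝ → ℝ := fun ω => ‖X ω - Y ω‖ ^ 2 with hD
  have hab0 : 0 ≤ a * b := mul_nonneg ha hb
  have hDi : Integrable D labelMeasure :=
    ((Lp.memLp X).sub (Lp.memLp Y)).integrable_norm_pow (p := 2) two_ne_zero
  have hDn : ∫ ω, D ω ∂labelMeasure = ‖X - Y‖ ^ 2 := by
    rw [Lp_two_norm_sq_eq_integral]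
    refine integral_congr_ae ?_
    filter_upwards [Lp.coeFn_sub X Y] with ω h
    rw [h, Pi.sub_apply]
  have hcomb := LabelSpace.coeFn_combination a b X Y
  have hinner : ∀ᵐ ω ∂labelMeasure, interaction W ((a • X + b • Y) ω) (a • X + b • Y) ≤
      a * interaction W (X ω) X + b * interaction W (Y ω) Y +
        a * b * M * (D ω + ‖X - Y‖ ^ 2) := by
    filter_upwards [hcomb] with ω hω
    have hiX := (integrable_interaction hlip (X ω) X).const_mul a
    have hiY := (integrable_interaction hlip (Y ω) Y).const_mul b
    have hiS : Integrable (fun ω' => a * W (X ω - X ω') + b * W (Y ω - Y ω')) labelMeasure :=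
      hiX.add hiY
    have hiD : Integrable (fun ω' => a * b * M * (D ω + D ω')) labelMeasure :=
      ((integrable_const (D ω)).add hDi).const_mul (a * b * M)
    have h := integral_mono_ae (integrable_interaction hlip ((a • X + b • Y) ω) (a • X + b • Y))
      (hiS.add hiD) (by
        filter_upwards [hcomb] with ω' hω'
        have h1 := hW.semiconvex (X ω - X ω') (Y ω - Y ω') ha hb hab
        have h2 : ‖X ω - X ω' - (Y ω - Y ω')‖ ^ 2 ≤ 2 * (D ω + D ω') := by
          rw [sub_sub_sub_comm]
          have e1 := norm_sub_le (X ω - Y ω) (X ω' - Y ω')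
          have e2 : ‖X ω - Y ω - (X ω' - Y ω')‖ ^ 2 ≤ (‖X ω - Y ω‖ + ‖X ω' - Y ω'‖) ^ 2 := by
            gcongr
          simp only [hD]
          nlinarith [sq_nonneg (‖X ω - Y ω‖ - ‖X ω' - Y ω'‖)]
        have h3 := mul_le_mul_of_nonneg_left h2 (show 0 ≤ a * b * (M / 2) by positivity)
        rw [hω, hω', show a • X ω + b • Y ω - (a • X ω' + b • Y ω') =
          a • (X ω - X ω') + b • (Y ω - Y ω') by module]
        simp only [Pi.add_apply]
        linarith)
    simp only [Pi.add_apply] at h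
    rwa [integral_add hiS hiD, integral_add hiX hiY, integral_const_mul,
      integral_const_mul, integral_const_mul, integral_add (integrable_const _) hDi,
      integral_const, probReal_univ, one_smul, hDn] at h
  have hjX := (hW.integrable_interaction_self X X).const_mul a
  have hjY := (hW.integrable_interaction_self Y Y).const_mul b
  have hjS : Integrable (fun ω => a * interaction W (X ω) X + b * interaction W (Y ω) Y)
      labelMeasure := hjX.add hjY
  have hjD : Integrable (fun ω => a * b * M * (D ω + ‖X - Y‖ ^ 2)) labelMeasure :=
    (hDi.add (integrable_const (‖X - Y‖ ^ 2))).const_mul (a * b * M)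
  have h := integral_mono_ae
    (hW.integrable_interaction_self (a • X + b • Y) (a • X + b • Y))
    (hjS.add hjD) hinner
  simp only [Pi.add_apply] at h
  rw [integral_add hjS hjD, integral_add hjX hjY, integral_const_mul,
    integral_const_mul, integral_const_mul, integral_add hDi (integrable_const _),
    integral_const, probReal_univ, one_smul, hDn] at h
  simp only [totalInteraction_eq]
  linarith

end IsInteractionFunction

end Interaction

/-! ### The collective and the individual problem -/

section Problems

variable {d : ℕ} {L : EuclideanSpace ℝ (Fin d) → EuclideanSpace ℝ (Fin d) → ℝ}
  {Φ Ψ : EuclideanSpace ℝ (Fin d) → ℝ} {c₀ c₁ l₀ cΦ cΨ T K m t : ℝ}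

/-- The action `∫_Ω L(X,V) dω ∈ [0,∞]` of a nonnegative Lagrangian on the label space. -/
noncomputable def labelAction
    (L : EuclideanSpace ℝ (Fin d) → EuclideanSpace ℝ (Fin d) → ℝ) (X V : LabelSpace d) : ℝ≥0∞ :=
  ∫⁻ ω, ENNReal.ofReal (L (X ω) (V ω)) ∂labelMeasure

theorem LabelSpace.exists_subseq_tendsto_ae {X : ℕ → LabelSpace d} {Y : LabelSpace d}
    (h : Tendsto X atTop (𝓝 Y)) :
    ∃ ns : ℕ → ℕ, StrictMono ns ∧
      ∀ᵐ ω ∂labelMeasure, Tendsto (fun i => X (ns i) ω) atTop (𝓝 (Y ω)) :=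
  (tendstoInMeasure_of_tendsto_Lp h).exists_seq_tendsto_ae

namespace IsAdmissibleLagrangian

theorem aestronglyMeasurable_comp (hL : IsAdmissibleLagrangian L c₀ c₁ l₀) (X V : LabelSpace d) :
    AEStronglyMeasurable (fun ω => L (X ω) (V ω)) labelMeasure :=
  hL.continuous.comp_aestronglyMeasurable
    ((Lp.aestronglyMeasurable X).prodMk (Lp.aestronglyMeasurable V))

/-- Sublevel sets are sequentially closed: pass to a subsequence for the positions, a further one
for the velocities, and apply Fatou to L ≥ 0. -/
theorem lowerSemicontinuous_labelAction (hL : IsAdmissibleLagrangian L c₀ c₁ l₀) :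
    LowerSemicontinuous fun z : LabelSpace d × LabelSpace d => labelAction L z.1 z.2 := by
  refine lowerSemicontinuous_iff_isClosed_preimage.2 fun a => IsSeqClosed.isClosed ?_
  intro z w hz hzw
  obtain ⟨ns, hns, hX⟩ := LabelSpace.exists_subseq_tendsto_ae
    ((continuous_fst.tendsto w).comp hzw)
  obtain ⟨ks, hks, hV⟩ := LabelSpace.exists_subseq_tendsto_ae
    (((continuous_snd.tendsto w).comp hzw).comp hns.tendsto_atTop)
  have hlim : ∀ᵐ ω ∂labelMeasure, Tendsto (fun i => ENNReal.ofReal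
      (L ((z (ns (ks i))).1 ω) ((z (ns (ks i))).2 ω))) atTop
      (𝓝 (ENNReal.ofReal (L (w.1 ω) (w.2 ω)))) := by
    filter_upwards [hX, hV] with ω h1 h2
    exact (ENNReal.continuous_ofReal.tendsto _).comp ((hL.continuous.tendsto _).comp
      ((h1.comp hks.tendsto_atTop).prodMk_nhds h2))
  calc labelAction L w.1 w.2
      = ∫⁻ ω, liminf (fun i => ENNReal.ofReal
          (L ((z (ns (ks i))).1 ω) ((z (ns (ks i))).2 ω))) atTop ∂labelMeasure := by
        refine lintegral_congr_ae ?_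
        filter_upwards [hlim] with ω h
        exact h.liminf_eq.symm
    _ ≤ liminf (fun i => labelAction L (z (ns (ks i))).1 (z (ns (ks i))).2) atTop :=
        lintegral_liminf_le' fun i => (hL.aestronglyMeasurable_comp _ _).aemeasurable.ennreal_ofReal
    _ ≤ liminf (fun _ : ℕ => a) atTop :=
        liminf_le_liminf (Eventually.of_forall fun i => hz (ns (ks i)))
    _ = a := liminf_const a

theorem abs_sub_le (hL : IsAdmissibleLagrangian L c₀ c₁ l₀) (x y v : EuclideanSpace ℝ (Fin d)) :
    |L x v - L y v| ≤ c₁ * ‖x - y‖ :=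
  Convex.norm_image_sub_le_of_norm_fderiv_le (𝕜 := ℝ) (f := fun z => L z v)
    (fun z _ => (hL.hasFDerivAt z v).differentiableAt) (fun z _ => hL.norm_fderiv_le z v)
    convex_univ (mem_univ y) (mem_univ x)

theorem labelAction_rest_ne_top (hL : IsAdmissibleLagrangian L c₀ c₁ l₀) (Y : LabelSpace d) :
    labelAction L Y 0 ≠ ∞ := by
  have hi : Integrable (fun ω => L (Y ω) 0) labelMeasure :=
    integrable_comp_of_lip (W := fun x => L x 0) (K := c₁) (fun x y => hL.abs_sub_le x y 0) Y
  have h : labelAction L Y 0 = ∫⁻ ω, ENNReal.ofReal (L (Y ω) 0) ∂labelMeasure := by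
    refine lintegral_congr_ae ?_
    filter_upwards [Lp.coeFn_zero (EuclideanSpace ℝ (Fin d)) 2 labelMeasure] with ω hω
    rw [hω, Pi.zero_apply]
  rw [h]
  exact hi.lintegral_lt_top.ne

theorem labelAction_convex (hL : IsAdmissibleLagrangian L c₀ c₁ l₀) (hl₀ : 0 ≤ l₀)
    (X₀ X₁ V₀ V₁ : LabelSpace d) {a b : ℝ} (ha : 0 ≤ a) (hb : 0 ≤ b) (hab : a + b = 1) :
    labelAction L (a • X₀ + b • X₁) (a • V₀ + b • V₁) +
      ENNReal.ofReal (a * b * (l₀ / 2) * ‖V₀ - V₁‖ ^ 2) ≤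
    ENNReal.ofReal a * labelAction L X₀ V₀ + ENNReal.ofReal b * labelAction L X₁ V₁ := by
  have hm := fun X V => (hL.aestronglyMeasurable_comp X V).aemeasurable.ennreal_ofReal
  have hk : 0 ≤ a * b * (l₀ / 2) := by positivity
  have hnorm : ENNReal.ofReal (a * b * (l₀ / 2) * ‖V₀ - V₁‖ ^ 2) =
      ∫⁻ ω, ENNReal.ofReal (a * b * (l₀ / 2) * ‖(V₀ - V₁) ω‖ ^ 2) ∂labelMeasure := by
    rw [Lp_two_norm_sq_eq_integral, ← integral_const_mul,
      ofReal_integral_eq_lintegral_ofReal ((V₀ - V₁).integrable_norm_sq.const_mul _)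
        (Eventually.of_forall fun ω => by positivity)]
  unfold labelAction
  rw [hnorm, ← lintegral_const_mul'' _ (hm X₀ V₀), ← lintegral_const_mul'' _ (hm X₁ V₁),
    ← lintegral_add_left' ((hm X₀ V₀).const_mul _), ← lintegral_add_left' (hm _ _)]
  refine lintegral_mono_ae ?_
  filter_upwards [LabelSpace.coeFn_combination a b X₀ X₁,
    LabelSpace.coeFn_combination a b V₀ V₁, Lp.coeFn_sub V₀ V₁] with ω h1 h2 h3
  rw [h1, h2, h3, Pi.sub_apply, ← ENNReal.ofReal_add (hL.nonneg _ _) (by positivity),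
    ← ENNReal.ofReal_mul ha, ← ENNReal.ofReal_mul hb,
    ← ENNReal.ofReal_add (mul_nonneg ha (hL.nonneg _ _)) (mul_nonneg hb (hL.nonneg _ _))]
  exact ENNReal.ofReal_le_ofReal (hL.strongly_convex _ _ _ _ ha hb hab)

theorem isConvexProblem_collective (hL : IsAdmissibleLagrangian L c₀ c₁ l₀) (hl₀ : 0 ≤ l₀)
    (hT : 0 ≤ T) (hΦ : IsInteractionFunction Φ cΦ) (hΨ : IsInteractionFunction Ψ cΨ)
    (hsmall : 2 * (T ^ 2 * (2 * ⨆ x, ‖iteratedFDeriv ℝ 2 Φ x‖) +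
      T * (2 * ⨆ x, ‖iteratedFDeriv ℝ 2 Ψ x‖)) < l₀)
    (hK : 0 ≤ K) (hKΦ : ∀ x, ‖fderiv ℝ Φ x‖ ≤ K) (hKΨ : ∀ x, ‖fderiv ℝ Ψ x‖ ≤ K)
    (hm : m ≤ 0) (hmΦ : ∀ x, m ≤ Φ x) (hmΨ : ∀ x, m ≤ Ψ x) :
    IsConvexProblem (labelAction L) (fun _ X => totalInteraction Φ X) (totalInteraction Ψ) T l₀
      (2 * ⨆ x, ‖iteratedFDeriv ℝ 2 Φ x‖) (2 * ⨆ x, ‖iteratedFDeriv ℝ 2 Ψ x‖) K m where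
  lsc := hL.lowerSemicontinuous_labelAction
  rest_finite := hL.labelAction_rest_ne_top
  convex X₀ X₁ V₀ V₁ _ _ ha hb hab := hL.labelAction_convex hl₀ X₀ X₁ V₀ V₁ ha hb hab
  potential_cont := by
    have h : Continuous (totalInteraction Φ) := (LipschitzWith.of_dist_le' (K := K) fun X Y => by
      rw [Real.dist_eq, dist_eq_norm X Y]
      exact hΦ.abs_totalInteraction_sub_le hK hKΦ X Y).continuous
    exact h.comp continuous_snd
  potential_lip _ X Y := hΦ.abs_totalInteraction_sub_le hK hKΦ X Y
  potential_ge _ X := (by linarith : m ≤ m / 2).trans (hΦ.le_totalInteraction hmΦ X)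
  potential_semiconvex _ X Y _ _ ha hb hab := hΦ.totalInteraction_semiconvex X Y ha hb hab
  initial_lip X Y := hΨ.abs_totalInteraction_sub_le hK hKΨ X Y
  initial_ge X := (by linarith : m ≤ m / 2).trans (hΨ.le_totalInteraction hmΨ X)
  initial_semiconvex X Y _ _ ha hb hab := hΨ.totalInteraction_semiconvex X Y ha hb hab
  T_nonneg := hT
  l_nonneg := hl₀
  cf_nonneg := mul_nonneg zero_le_two (IsInteractionFunction.iSup_nonneg Φ)
  cg_nonneg := mul_nonneg zero_le_two (IsInteractionFunction.iSup_nonneg Ψ)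
  K_nonneg := hK
  small := hsmall

/-- The modulus of a single interaction is ‖∇²Φ‖ or ‖∇²Ψ‖; the doubled one is kept so that both
problems share one smallness condition. Continuity of γ on all of ℝ provides the joint continuity of
the potential. -/
theorem isRegularProblem_individual (hL : IsAdmissibleLagrangian L c₀ c₁ l₀) (hl₀ : 0 ≤ l₀)
    (hc₀ : 0 < c₀) (hc₁ : 0 ≤ c₁)
    (hT : 0 ≤ T) (hΦ : IsInteractionFunction Φ cΦ) (hΨ : IsInteractionFunction Ψ cΨ)
    (hsmall : 2 * (T ^ 2 * (2 * ⨆ x, ‖iteratedFDeriv ℝ 2 Φ x‖) +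
      T * (2 * ⨆ x, ‖iteratedFDeriv ℝ 2 Ψ x‖)) < l₀)
    (hK : 0 ≤ K) (hKΦ : ∀ x, ‖fderiv ℝ Φ x‖ ≤ K) (hKΨ : ∀ x, ‖fderiv ℝ Ψ x‖ ≤ K)
    (hmΦ : ∀ x, m ≤ Φ x) (hmΨ : ∀ x, m ≤ Ψ x)
    {γ : ℝ → LabelSpace d} (hγ : Continuous γ) :
    IsRegularProblem L (fun x v => fderiv ℝ (fun z => L z v) x)
      (fun s q => interaction Φ q (γ s))
      (fun s q => ∫ ω, fderiv ℝ Φ (q - γ s ω) ∂labelMeasure)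
      (fun q => interaction Ψ q (γ 0)) T l₀
      (2 * ⨆ x, ‖iteratedFDeriv ℝ 2 Φ x‖) (2 * ⨆ x, ‖iteratedFDeriv ℝ 2 Ψ x‖) K m c₀ c₁ where
  lsc := (ENNReal.continuous_ofReal.comp hL.continuous).lowerSemicontinuous
  rest_finite _ := ofReal_ne_top
  convex x₀ x₁ v₀ v₁ a b ha hb hab := by
    rw [← ENNReal.ofReal_add (hL.nonneg _ _) (by positivity), ← ENNReal.ofReal_mul ha,
      ← ENNReal.ofReal_mul hb,
      ← ENNReal.ofReal_add (mul_nonneg ha (hL.nonneg _ _)) (mul_nonneg hb (hL.nonneg _ _))]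
    exact ENNReal.ofReal_le_ofReal (hL.strongly_convex _ _ _ _ ha hb hab)
  potential_cont := (continuous_integral_interaction (W := Φ) hK (hΦ.abs_sub_le hKΦ)).comp
    (continuous_snd.prodMk (hγ.comp continuous_fst))
  potential_lip s x y := by
    simpa using hΦ.abs_interaction_sub_le hK hKΦ x y (γ s) (γ s)
  potential_ge s x := hΦ.le_interaction hmΦ x (γ s)
  potential_semiconvex s x y a b ha hb hab := by
    refine (hΦ.interaction_semiconvex x y (γ s) ha hb hab).trans ?_
    have := IsInteractionFunction.iSup_nonneg Φ
    gcongr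
    linarith
  initial_lip x y := by
    simpa using hΨ.abs_interaction_sub_le hK hKΨ x y (γ 0) (γ 0)
  initial_ge x := hΨ.le_interaction hmΨ x (γ 0)
  initial_semiconvex x y a b ha hb hab := by
    refine (hΨ.interaction_semiconvex x y (γ 0) ha hb hab).trans ?_
    have := IsInteractionFunction.iSup_nonneg Ψ
    gcongr
    linarith
  T_nonneg := hT
  l_nonneg := hl₀
  cf_nonneg := mul_nonneg zero_le_two (IsInteractionFunction.iSup_nonneg Φ)
  cg_nonneg := mul_nonneg zero_le_two (IsInteractionFunction.iSup_nonneg Ψ)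
  K_nonneg := hK
  small := hsmall
  L_cont := hL.continuous
  L_nonneg := hL.nonneg
  c₀_pos := hc₀
  c₁_nonneg := hc₁
  L_ge := hL.lower_bound
  L_deriv := hL.hasFDerivAt
  L_deriv_cont := hL.continuous_fderiv
  L_deriv_le := hL.norm_fderiv_le
  f_deriv s x := hΦ.hasFDerivAt_interaction x (γ s)
  f_deriv_cont := (continuous_integral_interaction
    (IsInteractionFunction.iSup_nonneg Φ) hΦ.norm_fderiv_sub_le).comp
    (continuous_snd.prodMk (hγ.comp continuous_fst))
  f_deriv_le s x := IsInteractionFunction.norm_fderiv_interaction_le hKΦ x (γ s)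
  g_diff x := (hΨ.hasFDerivAt_interaction x (γ 0)).differentiableAt

theorem integrable_comp_of_labelAction_ne_top (hL : IsAdmissibleLagrangian L c₀ c₁ l₀)
    {X V : LabelSpace d} (h : labelAction L X V ≠ ∞) :
    Integrable (fun ω => L (X ω) (V ω)) labelMeasure := by
  refine ⟨hL.aestronglyMeasurable_comp X V, ?_⟩
  rw [hasFiniteIntegral_iff_ofReal (Eventually.of_forall fun ω => hL.nonneg _ _)]
  exact h.lt_top

theorem integral_comp_eq (hL : IsAdmissibleLagrangian L c₀ c₁ l₀) (X V : LabelSpace d) :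
    ∫ ω, L (X ω) (V ω) ∂labelMeasure = (labelAction L X V).toReal :=
  integral_eq_lintegral_of_nonneg_ae (Eventually.of_forall fun _ => hL.nonneg _ _)
    (hL.aestronglyMeasurable_comp X V)

end IsAdmissibleLagrangian

/-- Since L ≥ 0, integrability over labels at almost every time, and then over time, amounts to
finiteness of the iterated integral in [0,∞]. -/
theorem isCollectivePath_iff (hL : IsAdmissibleLagrangian L c₀ c₁ l₀)
    {f : ℝ → LabelSpace d → ℝ} {g : LabelSpace d → ℝ} {cf cg : ℝ}
    (P : IsConvexProblem (labelAction L) f g T l₀ cf cg K m) (ht : 0 ≤ t)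
    {Y : LabelSpace d} {γ γ' : ℝ → LabelSpace d} :
    IsCollectivePath L t Y γ γ' ↔ IsAdmissiblePath (labelAction L) t Y γ γ' := by
  constructor
  · rintro ⟨hac, hY, hae, hint⟩
    refine ⟨hac, hY, ?_⟩
    have h := ((intervalIntegrable_iff_integrableOn_Ioc_of_le ht).1 hint).lintegral_lt_top
    refine ne_top_of_le_ne_top h.ne (lintegral_mono_ae ?_)
    filter_upwards [hae] with s hs
    have hfin : labelAction L (γ s) (γ' s) ≠ ∞ := hs.lintegral_lt_top.ne
    rw [hL.integral_comp_eq, ENNReal.ofReal_toReal hfin]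
  · rintro ⟨hac, hY, hfin⟩
    have hm := P.aemeasurable_running hac
    refine ⟨hac, hY, ?_, ?_⟩
    · filter_upwards [ae_lt_top' hm hfin] with s hs
      exact hL.integrable_comp_of_labelAction_ne_top hs.ne
    · rw [intervalIntegrable_iff_integrableOn_Ioc_of_le ht]
      simp only [hL.integral_comp_eq]
      exact integrable_toReal_of_lintegral_ne_top hm hfin

theorem collectiveCost_eq (hL : IsAdmissibleLagrangian L c₀ c₁ l₀) {cf cg : ℝ}
    (P : IsConvexProblem (labelAction L) (fun _ X => totalInteraction Φ X) (totalInteraction Ψ)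
      T l₀ cf cg K m) (ht : 0 ≤ t) {Y : LabelSpace d} {γ γ' : ℝ → LabelSpace d}
    (h : IsAdmissiblePath (labelAction L) t Y γ γ') :
    collectiveCost L Φ Ψ t γ γ' =
      pathCost (labelAction L) (fun _ X => totalInteraction Φ X) (totalInteraction Ψ) t γ γ' := by
  have hm := P.aemeasurable_running h.ac
  unfold collectiveCost collectiveLagrangian pathCost
  simp only [hL.integral_comp_eq]
  rw [intervalIntegral.integral_add ((intervalIntegrable_iff_integrableOn_Ioc_of_le ht).2
    (integrable_toReal_of_lintegral_ne_top hm h.finite))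
    (P.intervalIntegrable_potential h.ac le_rfl ht le_rfl), intervalIntegral.integral_of_le ht,
    integral_toReal hm (ae_lt_top' hm h.finite)]

theorem isCollectiveMinimizer_iff (hL : IsAdmissibleLagrangian L c₀ c₁ l₀) {cf cg : ℝ}
    (P : IsConvexProblem (labelAction L) (fun _ X => totalInteraction Φ X) (totalInteraction Ψ)
      T l₀ cf cg K m) (ht : 0 ≤ t) {Y : LabelSpace d} {γ : ℝ → LabelSpace d} :
    IsCollectiveMinimizer L Φ Ψ t Y γ ↔ ∃ γ', IsAdmissiblePath (labelAction L) t Y γ γ' ∧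
      ∀ η η', IsAdmissiblePath (labelAction L) t Y η η' →
        pathCost (labelAction L) (fun _ X => totalInteraction Φ X) (totalInteraction Ψ) t γ γ' ≤
        pathCost (labelAction L) (fun _ X => totalInteraction Φ X) (totalInteraction Ψ) t η η' := by
  unfold IsCollectiveMinimizer
  refine exists_congr fun γ' => ?_
  rw [isCollectivePath_iff hL P ht]
  refine and_congr_right fun h => forall₂_congr fun η η' => ?_
  rw [isCollectivePath_iff hL P ht]
  refine forall_congr' fun k => ?_
  rw [collectiveCost_eq hL P ht h, collectiveCost_eq hL P ht k]

/-- Only the population on [0,t] enters the cost, so any curve γ agreeing there, in particular one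
independent of t, may replace the minimizer. -/
theorem optimalIndividualCost_eq {L₁ : EuclideanSpace ℝ (Fin d) → EuclideanSpace ℝ (Fin d) →
      EuclideanSpace ℝ (Fin d) →L[ℝ] ℝ}
    {f₁ : ℝ → EuclideanSpace ℝ (Fin d) → EuclideanSpace ℝ (Fin d) →L[ℝ] ℝ}
    {γ : ℝ → LabelSpace d} {cf cg : ℝ}
    (P : IsRegularProblem L L₁ (fun s q => interaction Φ q (γ s)) f₁
      (fun q => interaction Ψ q (γ 0)) T l₀ cf cg K m c₀ c₁) (ht : 0 ≤ t) {Y : LabelSpace d}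
    (hγ : EqOn (minimizingPath L Φ Ψ t Y) γ (Icc 0 t)) (q : EuclideanSpace ℝ (Fin d)) :
    optimalIndividualCost L Φ Ψ t q Y =
      valueFunction (fun x v => ENNReal.ofReal (L x v)) (fun s q => interaction Φ q (γ s))
        (fun q => interaction Ψ q (γ 0)) t q := by
  unfold optimalIndividualCost valueFunction
  congr 1
  ext c
  simp only [mem_ofPred_eq]
  refine exists₂_congr fun r r' => ?_
  have hcost : ∀ _ : IsAdmissiblePath (fun x v => ENNReal.ofReal (L x v)) t q r r',
      individualCost L Φ Ψ t (minimizingPath L Φ Ψ t Y) r r' =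
      pathCost (fun x v => ENNReal.ofReal (L x v)) (fun s q => interaction Φ q (γ s))
        (fun q => interaction Ψ q (γ 0)) t r r' := by
    intro h
    rw [P.pathCost_eq ht h, individualCost, hγ ⟨le_rfl, ht⟩, ← intervalIntegral.integral_of_le ht]
    congr 1
    refine intervalIntegral.integral_congr fun s hs => ?_
    rw [uIcc_of_le ht] at hs
    simp only [hγ hs]
  constructor
  · rintro ⟨hac, hq, hint, rfl⟩
    have h : IsAdmissiblePath (fun x v => ENNReal.ofReal (L x v)) t q r r' := ⟨hac, hq,
      ((intervalIntegrable_iff_integrableOn_Ioc_of_le ht).1 hint).lintegral_lt_top.ne⟩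
    exact ⟨h, hcost h⟩
  · rintro ⟨h, rfl⟩
    exact ⟨h.ac, h.terminal, (intervalIntegrable_iff_integrableOn_Ioc_of_le ht).2
      (P.integrable_running h Subset.rfl), (hcost h).symm⟩

theorem minimizingPath_spec {Y : LabelSpace d} (h : ∃ γ, IsCollectiveMinimizer L Φ Ψ t Y γ) :
    IsCollectiveMinimizer L Φ Ψ t Y (minimizingPath L Φ Ψ t Y) := by
  unfold minimizingPath
  rw [dif_pos h]
  exact h.choose_spec

end Problems

end

/-! ### The value function along the population trajectory. -/

theorem mainTheorem4 {d : ℕ}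
    (L H : EuclideanSpace ℝ (Fin d) → EuclideanSpace ℝ (Fin d) → ℝ)
    (Φ Ψ : EuclideanSpace ℝ (Fin d) → ℝ)
    (c₀ c₁ l₀ cΦ cΨ T : ℝ)
    (hc₀ : 0 < c₀) (hc₁ : 0 < c₁) (hl₀ : 0 < l₀) (hT : 0 < T)
    (hL : IsAdmissibleLagrangian L c₀ c₁ l₀)
    (hH : ContDiff ℝ 3 (Function.uncurry H))
    (hLH : ∀ q, IsLegendreTransform (L q) (H q))
    (hHL : ∀ q, IsLegendreTransform (H q) (L q))
    (hΦ : IsInteractionFunction Φ cΦ)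
    (hΨ : IsInteractionFunction Ψ cΨ)
    (hsmall : T ^ 2 * (max (-cΦ) 0 + 2 * ⨆ x, ‖iteratedFDeriv ℝ 2 Φ x‖) +
      T * (max (-cΨ) 0 + 2 * ⨆ x, ‖iteratedFDeriv ℝ 2 Ψ x‖) < l₀ / 2)
    (X : LabelSpace d) :
    -- the minimizers that enter the definition of `u` exist and are unique
    (∀ t ∈ Set.Icc 0 T, ∀ Y : LabelSpace d,
      IsCollectiveMinimizer L Φ Ψ t Y (minimizingPath L Φ Ψ t Y) ∧
      ∀ γ, IsCollectiveMinimizer L Φ Ψ t Y γ →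
        Set.EqOn γ (minimizingPath L Φ Ψ t Y) (Set.Icc 0 t)) ∧
    -- `u` has partial derivatives on `[0,T] × ℝᵈ` (one-sided in time at the two ends),
    -- and they are continuous
    (∀ t ∈ Set.Icc 0 T, ∀ q,
      DifferentiableWithinAt ℝ (fun s => individualValue L Φ Ψ T X s q) (Set.Icc 0 T) t ∧
      DifferentiableAt ℝ (individualValue L Φ Ψ T X t) q) ∧
    ContinuousOn
      (fun z : ℝ × EuclideanSpace ℝ (Fin d) =>
        derivWithin (fun s => individualValue L Φ Ψ T X s z.2) (Set.Icc 0 T) z.1)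
      (Set.Icc 0 T ×ˢ Set.univ) ∧
    ContinuousOn
      (fun z : ℝ × EuclideanSpace ℝ (Fin d) => gradient (individualValue L Φ Ψ T X z.1) z.2)
      (Set.Icc 0 T ×ˢ Set.univ) ∧
    -- the Hamilton–Jacobi equation
    (∀ t ∈ Set.Icc 0 T, ∀ q,
      derivWithin (fun s => individualValue L Φ Ψ T X s q) (Set.Icc 0 T) t +
        H q (gradient (individualValue L Φ Ψ T X t) q) -
        ∫ ω, Φ (q - minimizingPath L Φ Ψ T X t ω) ∂labelMeasure = 0) ∧
    -- the initial condition
    (∀ q, individualValue L Φ Ψ T X 0 q =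
      ∫ ω, Ψ (q - minimizingPath L Φ Ψ T X 0 ω) ∂labelMeasure) := by
  obtain ⟨K₁, hK₁, hKΦ⟩ := hΦ.exists_norm_fderiv_le
  obtain ⟨K₂, hK₂, hKΨ⟩ := hΨ.exists_norm_fderiv_le
  obtain ⟨m₁, hm₁⟩ := hΦ.bddBelow
  obtain ⟨m₂, hm₂⟩ := hΨ.bddBelow
  -- The terms with the negative parts of cΦ and cΨ are nonnegative and are dropped.
  have hsmall' : 2 * (T ^ 2 * (2 * ⨆ x, ‖iteratedFDeriv ℝ 2 Φ x‖) +
      T * (2 * ⨆ x, ‖iteratedFDeriv ℝ 2 Ψ x‖)) < l₀ := by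
    have h1 : 0 ≤ T ^ 2 * max (-cΦ) 0 := by positivity
    have h2 : 0 ≤ T * max (-cΨ) 0 := by positivity
    linarith
  have hK : 0 ≤ K₁ + K₂ := add_nonneg hK₁ hK₂
  have hKΦ' : ∀ x, ‖fderiv ℝ Φ x‖ ≤ K₁ + K₂ := fun x => (hKΦ x).trans (by linarith)
  have hKΨ' : ∀ x, ‖fderiv ℝ Ψ x‖ ≤ K₁ + K₂ := fun x => (hKΨ x).trans (by linarith)
  have hmΦ : ∀ x, min 0 (min m₁ m₂) ≤ Φ x := fun x =>
    ((min_le_right _ _).trans (min_le_left _ _)).trans (hm₁ x)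
  have hmΨ : ∀ x, min 0 (min m₁ m₂) ≤ Ψ x := fun x =>
    ((min_le_right _ _).trans (min_le_right _ _)).trans (hm₂ x)
  have P := hL.isConvexProblem_collective hl₀.le hT.le hΦ hΨ hsmall' hK hKΦ' hKΨ'
    (min_le_left _ _) hmΦ hmΨ
  have hmin : ∀ t ∈ Icc 0 T, ∀ Y : LabelSpace d,
      IsCollectiveMinimizer L Φ Ψ t Y (minimizingPath L Φ Ψ t Y) := fun t ht Y =>
    minimizingPath_spec (by
      obtain ⟨γ, γ', h⟩ := P.exists_minimizer ht Y
      exact ⟨γ, (isCollectiveMinimizer_iff hL P ht.1).2 ⟨γ', h⟩⟩)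
  have huniq : ∀ t ∈ Icc 0 T, ∀ Y : LabelSpace d, ∀ γ, IsCollectiveMinimizer L Φ Ψ t Y γ →
      EqOn γ (minimizingPath L Φ Ψ t Y) (Icc 0 t) := by
    intro t ht Y γ hγ
    obtain ⟨γ', h, hle⟩ := (isCollectiveMinimizer_iff hL P ht.1).1 hγ
    obtain ⟨η', k, kle⟩ := (isCollectiveMinimizer_iff hL P ht.1).1 (hmin t ht Y)
    exact P.eqOn_of_minimizers ht h k hle kle
  have hTT : T ∈ Icc 0 T := ⟨hT.le, le_rfl⟩
  set Γ := minimizingPath L Φ Ψ T X with hΓ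
  obtain ⟨Γ', hΓadm, hΓmin⟩ := (isCollectiveMinimizer_iff hL P hT.le).1 (hmin T hTT X)
  -- Frozen outside [0,T], where Γ carries no information, to obtain a globally continuous curve.
  set γ : ℝ → LabelSpace d := IccExtend hT.le ((Icc 0 T).domRestrict Γ) with hγ
  have hγc : Continuous γ := (hΓadm.ac.continuousOn.domRestrict).Icc_extend'
  have hγΓ : ∀ t ∈ Icc 0 T, γ t = Γ t := fun t ht => IccExtend_of_mem hT.le _ ht
  -- Consistency in time: Γ cut at t is a minimizer for Γ(t), hence by uniqueness the one used in
  -- û(t, ·, Γ(t)).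
  have hrestrict : ∀ t ∈ Icc 0 T, EqOn (minimizingPath L Φ Ψ t (Γ t)) γ (Icc 0 t) := by
    intro t ht s hs
    have h : IsCollectiveMinimizer L Φ Ψ t (Γ t) Γ :=
      (isCollectiveMinimizer_iff hL P ht.1).2 ⟨Γ', hΓadm.truncate ht.2, fun η η' k =>
        P.minimizer_truncate hΓadm hΓmin ht.1 ht.2 k⟩
    rw [hγΓ s ⟨hs.1, hs.2.trans ht.2⟩]
    exact (huniq t ht _ Γ h hs).symm
  have R := hL.isRegularProblem_individual hl₀.le hc₀ hc₁.le hT.le hΦ hΨ hsmall' hK hKΦ' hKΨ'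
    hmΦ hmΨ hγc
  set u := valueFunction (fun x v => ENNReal.ofReal (L x v)) (fun s q => interaction Φ q (γ s))
    (fun q => interaction Ψ q (γ 0)) with hu
  have hval : ∀ t ∈ Icc 0 T, individualValue L Φ Ψ T X t = u t := fun t ht =>
    funext fun q => optimalIndividualCost_eq R ht.1 (hrestrict t ht) q
  have htime : ∀ t ∈ Icc 0 T, ∀ q, HasDerivWithinAt (fun s => individualValue L Φ Ψ T X s q)
      (interaction Φ q (γ t) - H q (gradient (u t) q)) (Icc 0 T) t := fun t ht q =>
    (R.hasDerivWithinAt_value hH.continuous hLH ht q).congr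
      (fun s hs => by rw [hval s hs]) (by rw [hval t ht])
  have hderiv : ∀ t ∈ Icc 0 T, ∀ q,
      derivWithin (fun s => individualValue L Φ Ψ T X s q) (Icc 0 T) t =
      interaction Φ q (γ t) - H q (gradient (u t) q) := fun t ht q =>
    (htime t ht q).derivWithin (uniqueDiffOn_Icc hT t ht)
  refine ⟨fun t ht Y => ⟨hmin t ht Y, huniq t ht Y⟩, fun t ht q =>
    ⟨(htime t ht q).differentiableWithinAt, ?_⟩, ?_, ?_, fun t ht q => ?_, fun q => ?_⟩
  · rw [hval t ht]
    exact R.differentiable_value ht q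
  · refine ContinuousOn.congr (f := fun z : ℝ × EuclideanSpace ℝ (Fin d) =>
      interaction Φ z.2 (γ z.1) - H z.2 (gradient (u z.1) z.2)) ?_
      fun z hz => hderiv z.1 hz.1 z.2
    exact (R.potential_cont.continuousOn).sub (hH.continuous.comp_continuousOn
      (continuousOn_snd.prodMk R.continuousOn_gradient))
  · refine R.continuousOn_gradient.congr fun z hz => ?_
    rw [hval z.1 hz.1]
  · rw [hderiv t ht q, hval t ht, hγΓ t ht, interaction]
    ring
  · have h0 : (0 : ℝ) ∈ Icc 0 T := ⟨le_rfl, hT.le⟩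
    rw [hval 0 h0, hu, R.value_zero, hγΓ 0 h0, interaction]
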